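/- Let $\eta\in\mathbb C$ with $\operatorname{Im}\eta>0$, put $q^{1/2}=e^{i\eta}$, $q=e^{2i\eta}$ (so $0<|q|<1$; in particular $q\neq 1$), and let $a_1,\dots,a_4\in\mathbb C$ with $|a_j|<1$ and $|q^{-1/2}a_j|\neq 1$ for all $j$. Let $\sigma_j$ be the $j$-th elementary symmetric polynomial of $a_1,\dots,a_4$ and $(c;q)_\infty=\prod_{k\ge0}(1-cq^k)$. For $z\ne0$ write $$x=\tfrac12(z+z^{-1}),\qquad y_\pm=\tfrac12(q^{\pm1/2}z+q^{\mp1/2}z^{-1}),\qquad \Delta y=y_+-y_-,$$ and, for a function $f$ of $z$, $\mathbb D_xf=\big(f(q^{1/2}z)-f(q^{-1/2}z)\big)/\Delta y$ and $\mathbb M_xf=\tfrac12\big(f(q^{1/2}z)+f(q^{-1/2}z)\big)$. The Askey–Wilson weight is $$w(x)=\frac{(z^{2},z^{-2};q)_\infty}{\sin\theta\prod_{j=1}^4(a_jz,a_jz^{-1};q)_\infty},\qquad z=e^{i\theta},\quad \sin\theta=\frac{z-z^{-1}}{2i},\quad x\in G=(-1,1),$$ with $\theta\in(0,\pi)$ on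 $G$, and $\int_G\mathbb Dx\,g(x):=\frac{\sin\eta}{\eta}\int_{-1}^1g(x)\,dx$. Put $$W(x)=2(1+\sigma_4q^{-2})x^2-[q^{-1/2}\sigma_1+q^{-3/2}\sigma_3]x-1+q^{-1}\sigma_2-q^{-2}\sigma_4,$$ $$V(x)=2\frac{q^{-2}\sigma_4-1}{q^{1/2}-q^{-1/2}}x+\frac{q^{-1/2}\sigma_1-q^{-3/2}\sigma_3}{q^{1/2}-q^{-1/2}}.$$ Let $(p_n)_{n\ge0}$ be polynomials with $\deg p_n=n$ and $\int_G\mathbb Dx\,w\,p_np_m=\delta_{nm}$; write $p_n=\gamma_nx^n+\gamma_{n,1}x^{n-1}+\cdots$ (with $\gamma_{0,1}=0$), $p_{-1}=0$, and $$a_n=\gamma_{n-1}/\gamma_n\ (n\ge1),\qquad b_n=\gamma_{n,1}/\gamma_n-\gamma_{n+1,1}/\gamma_{n+1}\ (n\ge0).$$ For $x\notin[-1,1]$ let $f(x)=\int_G\mathbb Dy\,\frac{w(y)}{x-y}$, $p^{(1)}_{n-1}(x)=\int_G\mathbb Dy\,w(y)\frac{p_n(y)-p_n(x)}{y-x}$,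 $q_n=fp_n-p^{(1)}_{n-1}$ for $n\ge0$, and $q_{-1}=1/(a_0\gamma_0)$, where in the formulas defining the spectral coefficients $a_0$ is an arbitrary non-zero number. The spectral coefficients $W_n,\Theta_n,\Omega_n$ ($n\ge0$) are the polynomials in $x$ such that, for all $z$ with $|q^{1/2}z|>1$, $$\tfrac{2}{a_n}(2W_n-W)(x)=(W+\Delta yV)[p_n(y_+)q_{n-1}(y_-)-p_{n-1}(y_+)q_n(y_-)]+(W-\Delta yV)[p_n(y_-)q_{n-1}(y_+)-p_{n-1}(y_-)q_n(y_+)],$$ $$\Delta y\,\Theta_n(x)=(W+\Delta yV)p_n(y_+)q_n(y_-)-(W-\Delta yV)p_n(y_-)q_n(y_+),$$ $$\tfrac{2\Delta y}{a_n}(\Omega_n+V)(x)=(W+\Delta yV)[p_n(y_+)q_{n-1}(y_-)+p_{n-1}(y_+)q_n(y_-)]-(W-\Delta yV)[p_n(y_-)q_{n-1}(y_+)+p_{n-1}(y_-)q_n(y_+)].$$ Then: (0) $W\pm\Delta yV=z^{\mp2}\prod_{j=1}^4(1-a_jq^{-1/2}z^{\pm1})$ for all $z\neq0$; and for $|z|=1$,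 $z^2\ne1$, one has $W\pm\Delta yV\neq0$ and $W\,\mathbb D_xw=2V\,\mathbb M_xw$. (1) The spectral coefficients exist, are unique, and are given, for all $n\ge0$, by $$W_n(x)=(1+q^{-n})(1+\sigma_4q^{n-2})(x^2-1)-[q^{-1/2}\sigma_1+q^{-3/2}\sigma_3]x+1+q^{-1}\sigma_2+q^{-2}\sigma_4,$$ $$\Omega_n(x)+V(x)=2\frac{q^{n-2}\sigma_4-q^{-n}}{q^{1/2}-q^{-1/2}}x+\frac{q^{-n-1/2}\sigma_1+(-2+q^{-n})q^{-3/2}\sigma_3+(-2+q^n)q^{-5/2}\sigma_1\sigma_4+q^{n-7/2}\sigma_3\sigma_4}{(q^{1/2}-q^{-1/2})(q^{-n}-q^{n-2}\sigma_4)},$$ $$\Theta_n(x)=4\frac{q^{n-3/2}\sigma_4-q^{-n-1/2}}{q^{1/2}-q^{-1/2}},$$ where the assertion about $\Omega_n$ is made whenever $q^{-n}\neq q^{n-2}\sigma_4$ (which can fail only for $n=0$, $\sigma_4=q^2$). (2) With the convention $a_0=0$, the three-term recurrence $a_{n+1}p_{n+1}=(x-b_n)p_n-a_np_{n-1}$ holds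 for $n\ge0$, and for all $n\geq0$ $$a_n^2=\frac14\,\frac{(1-q^n)(1-\sigma_4q^{n-2})\prod_{j<k}(1-a_ja_kq^{n-1})}{(1-\sigma_4q^{2n-3})(1-\sigma_4q^{2n-2})^2(1-\sigma_4q^{2n-1})},$$ $$b_n=\big[\sigma_1(q+\sigma_4(q^{2n}-q^n-q^{n-1}))+\sigma_3(1-q^n-q^{n+1}+\sigma_4q^{2n-1})\big]\frac{q^{n-1}}{2(1-\sigma_4q^{2n})(1-\sigma_4q^{2n-2})},$$ each whenever its denominator does not vanish (for $n\ge1$ the first can fail only for $n=1$, $\sigma_4=q$; the second only for $n=0$, $\sigma_4=q^2$). -/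

import Mathlib

open Polynomial

noncomputable section

namespace AskeyWilson

/-! ### The base and the `q`-quadratic lattice -/

/-- The square root `q^{1/2} = e^{iη}` of the base. -/
def qhalf (η : ℂ) : ℂ := Complex.exp (Complex.I * η)

/-- The base `q = e^{2iη}`. -/
def qbase (η : ℂ) : ℂ := Complex.exp (2 * Complex.I * η)

/-- The projection `x = (z + z⁻¹)/2`. -/
def xOf (z : ℂ) : ℂ := (z + z⁻¹) / 2

/-- `y₊ = (q^{1/2} z + q^{-1/2} z⁻¹)/2`. -/
def yPlus (η z : ℂ) : ℂ := xOf (qhalf η * z)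

/-- `y₋ = (q^{-1/2} z + q^{1/2} z⁻¹)/2`. -/
def yMinus (η z : ℂ) : ℂ := xOf ((qhalf η)⁻¹ * z)

/-- `Δy = y₊ - y₋`. -/
def deltaY (η z : ℂ) : ℂ := yPlus η z - yMinus η z

/-- The Askey–Wilson divided-difference operator, on functions of `z`. -/
def dividedDiff (η : ℂ) (f : ℂ → ℂ) (z : ℂ) : ℂ :=
  (f (qhalf η * z) - f ((qhalf η)⁻¹ * z)) / deltaY η z

/-- The averaging operator, on functions of `z`. -/
def meanOp (η : ℂ) (f : ℂ → ℂ) (z : ℂ) : ℂ :=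
  (f (qhalf η * z) + f ((qhalf η)⁻¹ * z)) / 2

/-! ### The weight -/

/-- `(c; q)_∞ = ∏_{k ≥ 0} (1 - c q^k)`. -/
def qPochInf (c q : ℂ) : ℂ := ∏' k : ℕ, (1 - c * q ^ k)

/-- The Askey–Wilson weight as a function of `z = e^{iθ}`, with `sin θ = (z - z⁻¹)/(2i)`. -/
def weightZ (η : ℂ) (a : Fin 4 → ℂ) (z : ℂ) : ℂ :=
  (qPochInf (z ^ 2) (qbase η) * qPochInf ((z⁻¹) ^ 2) (qbase η)) /
    ((z - z⁻¹) / (2 * Complex.I) *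
      ∏ j, (qPochInf (a j * z) (qbase η) * qPochInf (a j * z⁻¹) (qbase η)))

/-- The Askey–Wilson weight on `(-1, 1)`, with `x = cos θ`, `θ ∈ (0, π)`. -/
def weight (η : ℂ) (a : Fin 4 → ℂ) (x : ℝ) : ℂ :=
  weightZ η a (Complex.exp (Complex.I * (Real.arccos x : ℂ)))

/-- `∫_G 𝔻x f(x) = (sin η / η) ∫_{-1}^{1} f(x) dx`. -/
def dIntegral (η : ℂ) (f : ℝ → ℂ) : ℂ :=
  Complex.sin η / η * ∫ x in (-1 : ℝ)..1, f x

/-- The `j`-th elementary symmetric polynomial of `a₁, …, a₄`. -/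
def sig (a : Fin 4 → ℂ) (j : ℕ) : ℂ :=
  ∑ s ∈ Finset.powersetCard j (Finset.univ : Finset (Fin 4)), ∏ i ∈ s, a i

/-! ### Spectral data of the weight -/

/-- The spectral data polynomial `W`. -/
def W (η : ℂ) (a : Fin 4 → ℂ) : ℂ[X] :=
  C (2 * (1 + sig a 4 * qbase η ^ (-2 : ℤ))) * X ^ 2
    - C (qhalf η ^ (-1 : ℤ) * sig a 1 + qhalf η ^ (-3 : ℤ) * sig a 3) * X
    + C (-1 + qbase η ^ (-1 : ℤ) * sig a 2 - qbase η ^ (-2 : ℤ) * sig a 4)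

/-- The spectral data polynomial `V`. -/
def V (η : ℂ) (a : Fin 4 → ℂ) : ℂ[X] :=
  C (2 * (qbase η ^ (-2 : ℤ) * sig a 4 - 1) / (qhalf η - (qhalf η)⁻¹)) * X
    + C ((qhalf η ^ (-1 : ℤ) * sig a 1 - qhalf η ^ (-3 : ℤ) * sig a 3) /
        (qhalf η - (qhalf η)⁻¹))

/-- `(W + Δy V)(x)` at `x = (z + z⁻¹)/2`. -/
def dataPlus (η : ℂ) (a : Fin 4 → ℂ) (z : ℂ) : ℂ :=
  (W η a).eval (xOf z) + deltaY η z * (V η a).eval (xOf z)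

/-- `(W - Δy V)(x)` at `x = (z + z⁻¹)/2`. -/
def dataMinus (η : ℂ) (a : Fin 4 → ℂ) (z : ℂ) : ℂ :=
  (W η a).eval (xOf z) - deltaY η z * (V η a).eval (xOf z)

/-! ### The orthogonal polynomial system -/

/-- `p` is an orthonormal polynomial system for the Askey–Wilson weight: `p n` has exact degree
`n`, and orthonormality is with respect to the (complex) bilinear form of the weight. -/
structure IsOPS (η : ℂ) (a : Fin 4 → ℂ) (p : ℕ → ℂ[X]) : Prop where
  degree_eq : ∀ n, (p n).degree = n
  orthonormal : ∀ n m,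
    dIntegral η (fun x => weight η a x * ((p n).eval (x : ℂ) * (p m).eval (x : ℂ)))
      = if n = m then 1 else 0

/-- The leading coefficient `γ_n`. -/
def gam (p : ℕ → ℂ[X]) (n : ℕ) : ℂ := (p n).coeff n

/-- The sub-leading coefficient `γ_{n,1}`, with `γ_{0,1} = 0`. -/
def gamSub (p : ℕ → ℂ[X]) : ℕ → ℂ
  | 0 => 0
  | n + 1 => (p (n + 1)).coeff n

/-- The recurrence coefficient `a_n = γ_{n-1}/γ_n` for `n ≥ 1`; the value `a₀` is not determined
by the polynomials and is supplied as an argument. -/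
def recA (p : ℕ → ℂ[X]) (a₀ : ℂ) : ℕ → ℂ
  | 0 => a₀
  | n + 1 => gam p n / gam p (n + 1)

/-- The recurrence coefficient `b_n = γ_{n,1}/γ_n - γ_{n+1,1}/γ_{n+1}`. -/
def recB (p : ℕ → ℂ[X]) (n : ℕ) : ℂ :=
  gamSub p n / gam p n - gamSub p (n + 1) / gam p (n + 1)

/-- `p_{n-1}`, with `p_{-1} = 0`. -/
def pPrev (p : ℕ → ℂ[X]) : ℕ → ℂ[X]
  | 0 => 0
  | n + 1 => p n

/-- The Stieltjes function `f(x) = ∫_G 𝔻y w(y)/(x - y)`. -/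
def stieltjes (η : ℂ) (a : Fin 4 → ℂ) (x : ℂ) : ℂ :=
  dIntegral η (fun y => weight η a y / (x - (y : ℂ)))

/-- The associated polynomial `p^{(1)}_{n-1}(x) = ∫_G 𝔻y w(y) (p_n(y) - p_n(x))/(y - x)`
(used for `x` off the interval `[-1, 1]`). -/
def assocPrev (η : ℂ) (a : Fin 4 → ℂ) (p : ℕ → ℂ[X]) (n : ℕ) (x : ℂ) : ℂ :=
  dIntegral η (fun y =>
    weight η a y * (((p n).eval (y : ℂ) - (p n).eval x) / ((y : ℂ) - x)))

/-- The associated function (function of the second kind) `q_n = f p_n - p^{(1)}_{n-1}`. -/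
def qFun (η : ℂ) (a : Fin 4 → ℂ) (p : ℕ → ℂ[X]) (n : ℕ) (x : ℂ) : ℂ :=
  stieltjes η a x * (p n).eval x - assocPrev η a p n x

/-- `q_{n-1}`, with `q_{-1} = 1/(a₀ γ₀)`. -/
def qFunPrev (η : ℂ) (a : Fin 4 → ℂ) (p : ℕ → ℂ[X]) (a₀ : ℂ) : ℕ → ℂ → ℂ
  | 0, _ => 1 / (a₀ * gam p 0)
  | n + 1, x => qFun η a p n x

/-! ### Spectral coefficients

Each is the polynomial in `x` defined by a bilinear formula in the polynomials and associated
functions. The formulas are read on the sheet `z → ∞`, for all `z` with `|q^{1/2} z| > 1`, which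
is where both `y₊` and `y₋` lie in the cut plane on that sheet. -/

/-- `P` is the spectral coefficient `W_n`. -/
def IsSpectralW (η : ℂ) (a : Fin 4 → ℂ) (p : ℕ → ℂ[X]) (a₀ : ℂ) (n : ℕ) (P : ℂ[X]) : Prop :=
  ∀ z : ℂ, 1 < ‖qhalf η * z‖ →
    2 / recA p a₀ n * (2 * P.eval (xOf z) - (W η a).eval (xOf z)) =
      dataPlus η a z *
          ((p n).eval (yPlus η z) * qFunPrev η a p a₀ n (yMinus η z)
            - (pPrev p n).eval (yPlus η z) * qFun η a p n (yMinus η z))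
        + dataMinus η a z *
          ((p n).eval (yMinus η z) * qFunPrev η a p a₀ n (yPlus η z)
            - (pPrev p n).eval (yMinus η z) * qFun η a p n (yPlus η z))

/-- `P` is the spectral coefficient `Θ_n`. -/
def IsSpectralTheta (η : ℂ) (a : Fin 4 → ℂ) (p : ℕ → ℂ[X]) (n : ℕ) (P : ℂ[X]) : Prop :=
  ∀ z : ℂ, 1 < ‖qhalf η * z‖ →
    deltaY η z * P.eval (xOf z) =
      dataPlus η a z * ((p n).eval (yPlus η z) * qFun η a p n (yMinus η z))
        - dataMinus η a z * ((p n).eval (yMinus η z) * qFun η a p n (yPlus η z))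

/-- `P` is the spectral coefficient `Ω_n`. -/
def IsSpectralOmega (η : ℂ) (a : Fin 4 → ℂ) (p : ℕ → ℂ[X]) (a₀ : ℂ) (n : ℕ) (P : ℂ[X]) :
    Prop :=
  ∀ z : ℂ, 1 < ‖qhalf η * z‖ →
    2 * deltaY η z / recA p a₀ n * (P.eval (xOf z) + (V η a).eval (xOf z)) =
      dataPlus η a z *
          ((p n).eval (yPlus η z) * qFunPrev η a p a₀ n (yMinus η z)
            + (pPrev p n).eval (yPlus η z) * qFun η a p n (yMinus η z))
        + dataMinus η a z *
          (-((p n).eval (yMinus η z) * qFunPrev η a p a₀ n (yPlus η z))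
            - (pPrev p n).eval (yMinus η z) * qFun η a p n (yPlus η z))

end AskeyWilson

end

noncomputable section

namespace AskeyWilson

/-! ### The base -/

/-! The weight is odd under $z\mapsto z^{-1}$ and obeys a first-order Pearson relation: away from
the zeros of the data, $(W+\Delta yV)\,w(q^{-1/2}z)$ and $(W-\Delta yV)\,w(q^{1/2}z)$ are the same
multiple of one odd function, `shiftedWeight`, analytic on $|q^{1/2}|\le|z|\le1$. Divide that
function of $u$ by $x(z)-x(u)$ and integrate over the circle $|u|=|q^{1/2}|$. Moving the contour to
the unit circle gives zero by oddness, while folding the circle and partial fractions express the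
same integral through Cauchy kernels at $y_\pm$. The outcome is `stieltjes_difference_equation`:
$(W+\Delta yV)f(y_-)-(W-\Delta yV)f(y_+)=K\Delta y$ with $K$ constant.

Consequently $f$ drops out of every bilinear form that defines a spectral coefficient, leaving a
Laurent polynomial in $z$ (`crossForm`, `crossForm_eq`). Inversion of $z$ swaps its two arguments up
to sign, and orthogonality bounds its growth, since $p_n\sim\gamma_nx^n$ and $q_n\sim
1/(\gamma_nx^{n+1})$. An odd Laurent polynomial that is $o(z)$ vanishes, and so does an even one
that is $o(z^2)$ and zero at $\pm1$. So finitely many data determine the forms: at most two terms of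
the expansion at infinity, and for $W_n$ the values at $z=\pm1$, where $\Delta y=0$ and the
Casoratian $1/a_n$ enters (`crossForm_self`, `crossForm_sub_eq`, `crossForm_add_eq`).

Once $W_n$ is known, the second term of its expansion is a new equation, and it yields
$\gamma_{n,1}/\gamma_n$ (`gamSub_div_gam`). This gives $b_n$ and the constant term of $\Omega_n+V$.
Finally, the $2\times2$ determinant of cross forms factors (`crossForm_det`); evaluated at $x=0$ it
is an equation for $a_n^2$ (`recA_sq_det`). -/

lemma qbase_eq_sq (η : ℂ) : qbase η = qhalf η ^ 2 := by
  rw [qbase, qhalf, ← Complex.exp_nat_mul]; congr 1; push_cast; ring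

lemma qhalf_ne_zero (η : ℂ) : qhalf η ≠ 0 := Complex.exp_ne_zero _

lemma qbase_ne_zero (η : ℂ) : qbase η ≠ 0 := Complex.exp_ne_zero _

lemma norm_qhalf_lt_one {η : ℂ} (hη : 0 < η.im) : ‖qhalf η‖ < 1 := by
  rw [qhalf, Complex.norm_exp, Real.exp_lt_one_iff]; simpa using hη

lemma norm_qbase_lt_one {η : ℂ} (hη : 0 < η.im) : ‖qbase η‖ < 1 := by
  rw [qbase_eq_sq, norm_pow]
  exact pow_lt_one₀ (norm_nonneg _) (norm_qhalf_lt_one hη) two_ne_zero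

lemma qhalf_sq_ne_one {η : ℂ} (hη : 0 < η.im) : qhalf η ^ 2 ≠ 1 := by
  intro h
  have := norm_qbase_lt_one hη
  rw [qbase_eq_sq, h] at this
  simp at this

lemma qhalf_sub_inv_ne_zero {η : ℂ} (hη : 0 < η.im) : qhalf η - (qhalf η)⁻¹ ≠ 0 := by
  intro h
  have h0 := qhalf_ne_zero η
  apply qhalf_sq_ne_one hη
  field_simp at h
  linear_combination h

/-! ### The infinite `q`-shifted factorial -/

lemma summable_norm_mul_pow {q : ℂ} (hq : ‖q‖ < 1) (c : ℂ) :
    Summable fun k : ℕ => ‖-(c * q ^ k)‖ := by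
  simpa using (summable_geometric_of_lt_one (norm_nonneg q) hq).mul_left ‖c‖

lemma qPochInf_eq_mul {q : ℂ} (hq : ‖q‖ < 1) (c : ℂ) :
    qPochInf c q = (1 - c) * qPochInf (q * c) q := by
  have h : Multipliable fun k : ℕ => (1 - c * q ^ (k + 1)) :=
    (multipliable_one_add_of_summable (summable_norm_mul_pow hq (q * c))).congr fun k => by ring
  have h2 : ∀ k : ℕ, 1 - q * c * q ^ k = 1 - c * q ^ (k + 1) := fun k => by ring
  have h3 := tprod_eq_zero_mul' (f := fun k : ℕ => 1 - c * q ^ k) h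
  simp only [qPochInf, h2]
  rw [h3, pow_zero, mul_one]

lemma qPochInf_ne_zero {q : ℂ} (hq : ‖q‖ < 1) {c : ℂ} (hc : ‖c‖ < 1) : qPochInf c q ≠ 0 := by
  have := tprod_one_add_ne_zero_of_summable (f := fun k : ℕ => -(c * q ^ k)) (fun k h => ?_)
    (summable_norm_mul_pow hq c)
  · simpa [qPochInf, sub_eq_add_neg] using this
  · have h1 : c * q ^ k = 1 := by linear_combination -h
    have h2 : ‖c * q ^ k‖ < 1 := by
      rw [norm_mul, norm_pow]
      exact mul_lt_one_of_nonneg_of_lt_one_left (norm_nonneg _) hc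
        (pow_le_one₀ (norm_nonneg _) hq.le)
    rw [h1] at h2
    simp at h2

/-- The product converges locally uniformly in $c$: on a ball of radius $\|c\|+1$ its terms are
dominated by a geometric series. -/
lemma differentiable_qPochInf {q : ℂ} (hq : ‖q‖ < 1) :
    Differentiable ℂ fun c => qPochInf c q := by
  intro c
  have hK : IsOpen (Metric.ball (0 : ℂ) (‖c‖ + 1)) := Metric.isOpen_ball
  have hprod := Summable.hasProdLocallyUniformlyOn_nat_one_add
    (f := fun (k : ℕ) (x : ℂ) => -(x * q ^ k)) hK
    ((summable_geometric_of_lt_one (norm_nonneg q) hq).mul_left (‖c‖ + 1))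
    (Filter.Eventually.of_forall fun k x hx => by
      rw [norm_neg, norm_mul, norm_pow]
      have : ‖x‖ < ‖c‖ + 1 := by simpa using hx
      gcongr)
    (fun k => by fun_prop)
  have hd := hprod.differentiableOn
    (Filter.Eventually.of_forall fun s => by
      simpa [Finset.prod_fn] using DifferentiableOn.finsetProd (fun _ _ => by fun_prop)) hK
  have := (hd c (by simp)).differentiableAt (hK.mem_nhds (by simp))
  simpa [qPochInf, sub_eq_add_neg] using this

/-! ### The spectral data -/

lemma sig_one (a : Fin 4 → ℂ) : sig a 1 = a 0 + a 1 + a 2 + a 3 := by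
  have : Finset.powersetCard 1 (Finset.univ : Finset (Fin 4)) = {{0}, {1}, {2}, {3}} := by decide
  rw [sig, this]
  repeat rw [Finset.sum_insert (by decide)]
  rw [Finset.sum_singleton]
  simp only [Finset.prod_singleton]
  ring

lemma sig_two (a : Fin 4 → ℂ) : sig a 2 =
    a 0 * a 1 + a 0 * a 2 + a 0 * a 3 + a 1 * a 2 + a 1 * a 3 + a 2 * a 3 := by
  have : Finset.powersetCard 2 (Finset.univ : Finset (Fin 4)) =
    {{0, 1}, {0, 2}, {0, 3}, {1, 2}, {1, 3}, {2, 3}} := by decide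
  rw [sig, this]
  repeat rw [Finset.sum_insert (by decide)]
  rw [Finset.sum_singleton]
  repeat rw [Finset.prod_pair (by decide)]
  ring

lemma sig_three (a : Fin 4 → ℂ) : sig a 3 =
    a 0 * a 1 * a 2 + a 0 * a 1 * a 3 + a 0 * a 2 * a 3 + a 1 * a 2 * a 3 := by
  have : Finset.powersetCard 3 (Finset.univ : Finset (Fin 4)) =
    {{0, 1, 2}, {0, 1, 3}, {0, 2, 3}, {1, 2, 3}} := by decide
  rw [sig, this]
  repeat rw [Finset.sum_insert (by decide)]
  rw [Finset.sum_singleton]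
  repeat rw [Finset.prod_insert (by decide), Finset.prod_pair (by decide)]
  ring

lemma sig_four (a : Fin 4 → ℂ) : sig a 4 = a 0 * a 1 * a 2 * a 3 := by
  have : Finset.powersetCard 4 (Finset.univ : Finset (Fin 4)) = {Finset.univ} := by decide
  rw [sig, this, Finset.sum_singleton, Fin.prod_univ_four]

lemma prod_one_sub_mul (a : Fin 4 → ℂ) (t : ℂ) : ∏ j, (1 - a j * t) =
    1 - sig a 1 * t + sig a 2 * t ^ 2 - sig a 3 * t ^ 3 + sig a 4 * t ^ 4 := by
  rw [Fin.prod_univ_four, sig_one, sig_two, sig_three, sig_four]; ring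

lemma eval_W (η : ℂ) (a : Fin 4 → ℂ) (x : ℂ) : (W η a).eval x =
    2 * (1 + sig a 4 / qhalf η ^ 4) * x ^ 2 - (sig a 1 / qhalf η + sig a 3 / qhalf η ^ 3) * x
      + (-1 + sig a 2 / qhalf η ^ 2 - sig a 4 / qhalf η ^ 4) := by
  have h0 := qhalf_ne_zero η
  simp only [W, eval_add, eval_sub, eval_mul, eval_C, eval_pow, eval_X, qbase_eq_sq]
  simp only [zpow_neg, zpow_ofNat]
  field_simp

lemma eval_V (η : ℂ) (a : Fin 4 → ℂ) (x : ℂ) : (V η a).eval x =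
    (2 * (sig a 4 / qhalf η ^ 4 - 1) * x + (sig a 1 / qhalf η - sig a 3 / qhalf η ^ 3)) /
      (qhalf η - (qhalf η)⁻¹) := by
  simp only [V, eval_add, eval_mul, eval_C, eval_X, qbase_eq_sq]
  simp only [zpow_neg, zpow_ofNat]
  ring

lemma deltaY_eq (η z : ℂ) : deltaY η z = (qhalf η - (qhalf η)⁻¹) * (z - z⁻¹) / 2 := by
  simp only [deltaY, yPlus, yMinus, xOf, mul_inv, inv_inv]; ring

/-- $\Delta y$ carries the factor $q^{1/2}-q^{-1/2}$, which cancels the denominator of $V$. -/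
lemma deltaY_mul_eval_V {η : ℂ} (hη : 0 < η.im) (a : Fin 4 → ℂ) (z x : ℂ) :
    deltaY η z * (V η a).eval x =
    (z - z⁻¹) / 2 *
      (2 * (sig a 4 / qhalf η ^ 4 - 1) * x + (sig a 1 / qhalf η - sig a 3 / qhalf η ^ 3)) := by
  have hk := qhalf_sub_inv_ne_zero hη
  rw [eval_V, deltaY_eq]
  generalize qhalf η - (qhalf η)⁻¹ = k at *
  field_simp

lemma dataPlus_eq {η : ℂ} (hη : 0 < η.im) (a : Fin 4 → ℂ) {z : ℂ} (hz : z ≠ 0) :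
    dataPlus η a z = z ^ (-2 : ℤ) * ∏ j, (1 - a j * (qhalf η)⁻¹ * z) := by
  have h0 := qhalf_ne_zero η
  simp only [mul_assoc (a _)]
  rw [prod_one_sub_mul, dataPlus, deltaY_mul_eval_V hη, eval_W, xOf]
  simp only [zpow_neg, zpow_ofNat]
  field_simp
  ring

lemma dataMinus_eq_dataPlus_inv (η : ℂ) (a : Fin 4 → ℂ) (z : ℂ) :
    dataMinus η a z = dataPlus η a z⁻¹ := by
  simp only [dataMinus, dataPlus, deltaY_eq, xOf, inv_inv, add_comm z⁻¹ z]; ring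

lemma dataPlus_expand {η : ℂ} (hη : 0 < η.im) (a : Fin 4 → ℂ) {z : ℂ} (hz : z ≠ 0) :
    dataPlus η a z = 1 / z ^ 2 - sig a 1 / qhalf η / z + sig a 2 / qhalf η ^ 2
      - sig a 3 / qhalf η ^ 3 * z + sig a 4 / qhalf η ^ 4 * z ^ 2 := by
  have h0 := qhalf_ne_zero η
  rw [dataPlus_eq hη a hz]
  simp only [mul_assoc (a _)]
  rw [prod_one_sub_mul]
  simp only [zpow_neg, zpow_ofNat]
  field_simp

lemma dataMinus_eq {η : ℂ} (hη : 0 < η.im) (a : Fin 4 → ℂ) {z : ℂ} (hz : z ≠ 0) :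
    dataMinus η a z = z ^ (2 : ℤ) * ∏ j, (1 - a j * (qhalf η)⁻¹ * z⁻¹) := by
  rw [dataMinus_eq_dataPlus_inv, dataPlus_eq hη a (inv_ne_zero hz)]
  simp

/-! ### The weight as a function of `z` -/

/-- The product of the Askey–Wilson weight at `q^{-1/2} z` and `W + Δy V`, up to a constant. -/
def shiftedWeight (η : ℂ) (a : Fin 4 → ℂ) (z : ℂ) : ℂ :=
  (z⁻¹ - z) * (qPochInf (qbase η * z ^ 2) (qbase η) * qPochInf (qbase η * (z⁻¹) ^ 2) (qbase η)) /
    ∏ j, (qPochInf (a j * (qhalf η * z)) (qbase η) * qPochInf (a j * (qhalf η * z⁻¹)) (qbase η))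

lemma weightZ_inv (η : ℂ) (a : Fin 4 → ℂ) (z : ℂ) : weightZ η a z⁻¹ = -weightZ η a z := by
  simp only [weightZ, inv_inv]
  rw [mul_comm (qPochInf (z⁻¹ ^ 2) _), ← neg_sub z z⁻¹]
  simp only [mul_comm (qPochInf (a _ * z⁻¹) _)]
  rw [neg_div, neg_mul, div_neg]

lemma shiftedWeight_inv (η : ℂ) (a : Fin 4 → ℂ) (z : ℂ) :
    shiftedWeight η a z⁻¹ = -shiftedWeight η a z := by
  simp only [shiftedWeight, inv_inv]
  rw [mul_comm (qPochInf (qbase η * z⁻¹ ^ 2) _), ← neg_sub z⁻¹ z]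
  simp only [mul_comm (qPochInf (a _ * (qhalf η * z⁻¹)) _)]
  rw [neg_mul, neg_div]

/-- Since $(1-z^2)(1-z^{-2})=4\sin^2\theta$, the sine moves from the denominator to the numerator,
and the weight is seen to extend continuously by zero to the endpoints. At $z=\pm1$ the original
quotient is already $0$ by the convention for division by zero. -/
lemma weightZ_eq {η : ℂ} (hη : 0 < η.im) (a : Fin 4 → ℂ) {z : ℂ} (hz : z ≠ 0) :
    weightZ η a z = 4 * ((z - z⁻¹) / (2 * Complex.I)) *
      (qPochInf (qbase η * z ^ 2) (qbase η) * qPochInf (qbase η * (z⁻¹) ^ 2) (qbase η)) /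
        ∏ j, (qPochInf (a j * z) (qbase η) * qPochInf (a j * z⁻¹) (qbase η)) := by
  have hq := norm_qbase_lt_one hη
  rw [weightZ, qPochInf_eq_mul hq (z ^ 2), qPochInf_eq_mul hq (z⁻¹ ^ 2)]
  by_cases hs : (z - z⁻¹) / (2 * Complex.I) = 0
  · simp [hs]
  · have h4 : (1 - z ^ 2) * (1 - z⁻¹ ^ 2) = 4 * ((z - z⁻¹) / (2 * Complex.I)) ^ 2 := by
      rw [div_pow, mul_pow, Complex.I_sq]; field_simp; ring
    rw [show (1 - z ^ 2) * qPochInf (qbase η * z ^ 2) (qbase η) *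
      ((1 - z⁻¹ ^ 2) * qPochInf (qbase η * z⁻¹ ^ 2) (qbase η)) =
      ((1 - z ^ 2) * (1 - z⁻¹ ^ 2)) * (qPochInf (qbase η * z ^ 2) (qbase η) *
        qPochInf (qbase η * z⁻¹ ^ 2) (qbase η)) by ring, h4,
      show 4 * ((z - z⁻¹) / (2 * Complex.I)) ^ 2 * (qPochInf (qbase η * z ^ 2) (qbase η) *
        qPochInf (qbase η * z⁻¹ ^ 2) (qbase η)) = ((z - z⁻¹) / (2 * Complex.I)) *
        (4 * ((z - z⁻¹) / (2 * Complex.I)) * (qPochInf (qbase η * z ^ 2) (qbase η) *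
        qPochInf (qbase η * z⁻¹ ^ 2) (qbase η))) by ring, mul_div_mul_left _ _ hs]

/-- One half of the Pearson relation. The $q$-shift of each infinite product releases one factor,
and those from the denominator are exactly the factors of $W+\Delta yV$. -/
lemma dataPlus_mul_weightZ {η : ℂ} (hη : 0 < η.im) (a : Fin 4 → ℂ) {z : ℂ} (hz : z ≠ 0)
    (hne : ∀ j, 1 - a j * (qhalf η)⁻¹ * z ≠ 0) :
    dataPlus η a z * weightZ η a ((qhalf η)⁻¹ * z) =
      -(2 * Complex.I / qhalf η) * shiftedWeight η a z := by
  have hq := norm_qbase_lt_one hη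
  have h0 := qhalf_ne_zero η
  rw [dataPlus_eq hη a hz, weightZ, shiftedWeight]
  have e1 : qPochInf (((qhalf η)⁻¹ * z) ^ 2) (qbase η) =
      (1 - ((qhalf η)⁻¹ * z) ^ 2) * ((1 - z ^ 2) * qPochInf (qbase η * z ^ 2) (qbase η)) := by
    rw [qPochInf_eq_mul hq, ← qPochInf_eq_mul hq (z ^ 2)]
    congr 2
    rw [qbase_eq_sq]; field_simp
  have e2 : ((qhalf η)⁻¹ * z)⁻¹ ^ 2 = qbase η * (z⁻¹) ^ 2 := by
    rw [qbase_eq_sq, mul_inv, inv_inv, mul_pow]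
  have e3 : ∀ j, qPochInf (a j * ((qhalf η)⁻¹ * z)) (qbase η) =
      (1 - a j * (qhalf η)⁻¹ * z) * qPochInf (a j * (qhalf η * z)) (qbase η) := by
    intro j
    rw [qPochInf_eq_mul hq, ← mul_assoc (a j)]
    congr 2
    rw [qbase_eq_sq]; field_simp
  have e4 : ((qhalf η)⁻¹ * z)⁻¹ = qhalf η * z⁻¹ := by rw [mul_inv, inv_inv]
  rw [e2, e1, e4]
  simp only [e3, mul_assoc (1 - a _ * (qhalf η)⁻¹ * z)]
  rw [Finset.prod_mul_distrib]
  have hP : ∏ j, (1 - a j * (qhalf η)⁻¹ * z) ≠ 0 := Finset.prod_ne_zero_iff.2 fun j _ => hne j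
  generalize ∏ j, (1 - a j * (qhalf η)⁻¹ * z) = A at *
  generalize (∏ j, (qPochInf (a j * (qhalf η * z)) (qbase η) *
    qPochInf (a j * (qhalf η * z⁻¹)) (qbase η))) = B
  -- At $z=\pm q^{1/2}$ the sine in the weight is zero, so the left side is $0$ by convention; on
  -- the right, $(qz^{-2};q)_\infty$ vanishes there.
  by_cases hs : 1 - ((qhalf η)⁻¹ * z) ^ 2 = 0
  · have : qPochInf (qbase η * z⁻¹ ^ 2) (qbase η) = 0 := by
      have e : qbase η * z⁻¹ ^ 2 = 1 := by
        rw [qbase_eq_sq]; field_simp at hs ⊢; linear_combination hs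
      rw [e, qPochInf_eq_mul hq]; simp
    rw [this]; simp only [mul_zero, zero_div]
  · generalize qPochInf (qbase η * z ^ 2) (qbase η) = P1
    generalize qPochInf (qbase η * z⁻¹ ^ 2) (qbase η) = P2
    have e5 : ((qhalf η)⁻¹ * z - qhalf η * z⁻¹) / (2 * Complex.I) =
      (1 - ((qhalf η)⁻¹ * z) ^ 2) * (-(qhalf η * z⁻¹ / (2 * Complex.I))) := by
      field_simp; ring
    rw [e5]
    generalize 1 - ((qhalf η)⁻¹ * z) ^ 2 = S at *
    have hI := Complex.I_ne_zero
    by_cases hB : B = 0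
    · simp [hB]
    simp only [zpow_neg, zpow_ofNat]
    field_simp

/-- The image of the previous relation under $z\mapsto z^{-1}$: the weight and `shiftedWeight` both
change sign. -/
lemma dataMinus_mul_weightZ {η : ℂ} (hη : 0 < η.im) (a : Fin 4 → ℂ) {z : ℂ} (hz : z ≠ 0)
    (hne : ∀ j, 1 - a j * (qhalf η)⁻¹ * z⁻¹ ≠ 0) :
    dataMinus η a z * weightZ η a (qhalf η * z) =
      -(2 * Complex.I / qhalf η) * shiftedWeight η a z := by
  have h := dataPlus_mul_weightZ hη a (inv_ne_zero hz) hne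
  rw [shiftedWeight_inv, ← dataMinus_eq_dataPlus_inv, ← mul_inv, weightZ_inv] at h
  linear_combination -h

lemma data_ne_zero_and_semiclassical {η : ℂ} (hη : 0 < η.im) (a : Fin 4 → ℂ)
    (ha' : ∀ j, ‖(qhalf η)⁻¹ * a j‖ ≠ 1) {z : ℂ} (hz : ‖z‖ = 1) (hz2 : z ^ 2 ≠ 1) :
    dataPlus η a z ≠ 0 ∧ dataMinus η a z ≠ 0 ∧
      (W η a).eval (xOf z) * dividedDiff η (weightZ η a) z =
        2 * (V η a).eval (xOf z) * meanOp η (weightZ η a) z := by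
  have hz0 : z ≠ 0 := by rintro rfl; simp at hz
  have key : ∀ w : ℂ, ‖w‖ = 1 → ∀ j, 1 - a j * (qhalf η)⁻¹ * w ≠ 0 := by
    intro w hw j h
    apply ha' j
    have h1 : a j * (qhalf η)⁻¹ * w = 1 := by linear_combination -h
    have h2 := congrArg norm h1
    rw [norm_mul, hw, mul_one, mul_comm] at h2
    simpa using h2
  have hzi : ‖z⁻¹‖ = 1 := by simp [hz]
  have hP : ∀ w : ℂ, ‖w‖ = 1 → ∏ j, (1 - a j * (qhalf η)⁻¹ * w) ≠ 0 := fun w hw =>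
    Finset.prod_ne_zero_iff.2 fun j _ => key w hw j
  refine ⟨?_, ?_, ?_⟩
  · rw [dataPlus_eq hη a hz0]
    exact mul_ne_zero (zpow_ne_zero _ hz0) (hP z hz)
  · rw [dataMinus_eq hη a hz0]
    exact mul_ne_zero (zpow_ne_zero _ hz0) (hP _ hzi)
  · have h1 := dataPlus_mul_weightZ hη a hz0 (key z hz)
    have h2 := dataMinus_mul_weightZ hη a hz0 (key _ hzi)
    have hd : deltaY η z ≠ 0 := by
      rw [deltaY_eq]
      refine div_ne_zero (mul_ne_zero (qhalf_sub_inv_ne_zero hη) fun h => hz2 ?_) two_ne_zero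
      field_simp at h
      linear_combination h
    rw [dividedDiff, meanOp]
    rw [dataPlus] at h1
    rw [dataMinus] at h2
    generalize weightZ η a ((qhalf η)⁻¹ * z) = w1 at *
    generalize weightZ η a (qhalf η * z) = w2 at *
    field_simp
    linear_combination h2 - h1

/-! ### Integrals over circles -/

-- Cauchy's theorem on an annulus for $H(z)/z$, whose circle integrals are angular means of $H$.
open Complex in
lemma integral_circle_shift {H : ℂ → ℂ} {c : ℂ} (hc0 : c ≠ 0) (hc1 : ‖c‖ ≤ 1)
    (hd : ∀ z, ‖c‖ ≤ ‖z‖ → ‖z‖ ≤ 1 → DifferentiableAt ℂ H z) :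
    ∫ θ in (0 : ℝ)..2 * Real.pi, H (c * exp (θ * I)) =
      ∫ θ in (0 : ℝ)..2 * Real.pi, H (exp (θ * I)) := by
  have h := circleIntegral_sub_center_inv_smul_eq_of_differentiable_on_annulus_off_countable
    (c := 0) (norm_pos_iff.2 hc0) hc1 (f := H) (s := ∅) Set.countable_empty
    (fun z hz => by
      simp only [Set.mem_sdiff, Metric.mem_closedBall, dist_zero_right, Metric.mem_ball,
        not_lt] at hz
      exact (hd z hz.2 hz.1).continuousAt.continuousWithinAt)
    (fun z hz => by
      simp only [Set.sdiff_empty, Set.mem_sdiff, Metric.mem_closedBall, dist_zero_right,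
        Metric.mem_ball, not_le] at hz
      exact hd z hz.2.le hz.1.le)
  have hr : ∀ r : ℝ, r ≠ 0 → (∮ z in C(0, r), (z - 0)⁻¹ • H z) =
      I * ∫ θ in (0 : ℝ)..2 * Real.pi, H (r * exp (θ * I)) := by
    intro r hr
    rw [circleIntegral, ← intervalIntegral.integral_const_mul]
    refine intervalIntegral.integral_congr fun θ _ => ?_
    have hr' : (r : ℂ) ≠ 0 := ofReal_ne_zero.2 hr
    have he := exp_ne_zero ((θ : ℂ) * I)
    simp only [deriv_circleMap, circleMap, zero_add, sub_zero, smul_eq_mul]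
    generalize exp ((θ : ℂ) * I) = e at *
    generalize H (r * e) = v
    field_simp
  rw [hr _ one_ne_zero, hr _ (norm_ne_zero_iff.2 hc0)] at h
  have h1 := mul_left_cancel₀ I_ne_zero h
  simp only [ofReal_one, one_mul] at h1
  rw [h1]
  -- The argument of `c` only rotates the inner circle, which does not change an integral over a
  -- full period.
  have hper : Function.Periodic (fun θ : ℝ => H (‖c‖ * exp (θ * I))) (2 * Real.pi) := by
    intro θ
    simp only [ofReal_add, ofReal_mul, ofReal_ofNat, add_mul, exp_add, exp_two_pi_mul_I, mul_one]
  have h2 := hper.intervalIntegral_add_eq (arg c) 0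
  rw [zero_add] at h2
  rw [← h2]
  have h3 := intervalIntegral.integral_comp_add_right (a := 0) (b := 2 * Real.pi)
    (fun θ : ℝ => H (‖c‖ * exp (θ * I))) (arg c)
  rw [zero_add, add_comm (2 * Real.pi)] at h3
  rw [← h3]
  refine intervalIntegral.integral_congr fun θ _ => ?_
  simp only [ofReal_add, add_mul, exp_add]
  congr 1
  conv_lhs => rw [← norm_mul_exp_arg_mul_I c]
  ring

-- The lower half circle is folded onto the upper one by $\theta\mapsto2\pi-\theta$, which inverts
-- the point.
open Complex in
lemma integral_circle_eq_add {g : ℂ → ℂ} (hg : Continuous fun θ : ℝ => g (exp (θ * I))) :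
    ∫ θ in (0 : ℝ)..2 * Real.pi, g (exp (θ * I)) =
      ∫ θ in (0 : ℝ)..Real.pi, (g (exp (θ * I)) + g (exp (θ * I))⁻¹) := by
  have hinv : ∀ θ : ℝ, exp (((2 * Real.pi - θ : ℝ) : ℂ) * I) = (exp (θ * I))⁻¹ := by
    intro θ
    rw [← exp_neg]
    push_cast
    rw [sub_mul, exp_sub, exp_two_pi_mul_I, exp_neg, one_div]
  have h1 := intervalIntegral.integral_comp_sub_left (a := 0) (b := Real.pi)
    (fun θ : ℝ => g (exp (θ * I))) (2 * Real.pi)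
  simp only [hinv, sub_zero] at h1
  rw [show 2 * Real.pi - Real.pi = Real.pi by ring] at h1
  have hg' : Continuous fun θ : ℝ => g (exp (θ * I))⁻¹ := by
    simp only [← hinv]
    exact hg.comp (by fun_prop : Continuous fun θ : ℝ => 2 * Real.pi - θ)
  rw [intervalIntegral.integral_add (hg.intervalIntegrable _ _) (hg'.intervalIntegrable _ _), h1,
    intervalIntegral.integral_add_adjacent_intervals (hg.intervalIntegrable _ _)
      (hg.intervalIntegrable _ _)]

open Complex in
lemma integral_circle_eq_zero_of_antisymm {g : ℂ → ℂ}
    (hg : Continuous fun θ : ℝ => g (exp (θ * I))) (h : ∀ z, g z⁻¹ = -g z) :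
    ∫ θ in (0 : ℝ)..2 * Real.pi, g (exp (θ * I)) = 0 := by
  rw [integral_circle_eq_add hg]
  simp [h]

/-! ### Continuity of the weight -/

lemma weight_continuous {η : ℂ} (hη : 0 < η.im) {a : Fin 4 → ℂ} (ha : ∀ j, ‖a j‖ < 1) :
    Continuous (weight η a) := by
  have hq := norm_qbase_lt_one hη
  have hc := (differentiable_qPochInf hq).continuous
  have hE : Continuous fun x : ℝ => Complex.exp (Complex.I * (Real.arccos x : ℂ)) := by fun_prop
  have hn : ∀ x : ℝ, ‖Complex.exp (Complex.I * (Real.arccos x : ℂ))‖ = 1 := fun x => by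
    rw [mul_comm]; exact Complex.norm_exp_ofReal_mul_I _
  have hEi : Continuous fun x : ℝ => (Complex.exp (Complex.I * (Real.arccos x : ℂ)))⁻¹ :=
    hE.inv₀ fun _ => Complex.exp_ne_zero _
  have : weight η a = fun x : ℝ => weightZ η a (Complex.exp (Complex.I * (Real.arccos x : ℂ))) := rfl
  rw [this]
  simp only [weightZ_eq hη a (Complex.exp_ne_zero _)]
  refine Continuous.div ?_ ?_ ?_
  · exact ((continuous_const.mul ((hE.sub hEi).div_const _))).mul
      ((hc.comp (continuous_const.mul (hE.pow 2))).mul (hc.comp (continuous_const.mul (hEi.pow 2))))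
  · exact continuous_finsetProd _ fun j _ => (hc.comp (continuous_const.mul hE)).mul
      (hc.comp (continuous_const.mul hEi))
  · intro x
    refine Finset.prod_ne_zero_iff.2 fun j _ => mul_ne_zero ?_ ?_ <;>
    · apply qPochInf_ne_zero hq
      simpa [norm_mul, hn] using ha j

lemma differentiableAt_shiftedWeight {η : ℂ} (hη : 0 < η.im) {a : Fin 4 → ℂ} (ha : ∀ j, ‖a j‖ < 1)
    {z : ℂ} (h1 : ‖qhalf η‖ ≤ ‖z‖) (h2 : ‖z‖ ≤ 1) :
    DifferentiableAt ℂ (shiftedWeight η a) z := by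
  have hq := norm_qbase_lt_one hη
  have hh := norm_qhalf_lt_one hη
  have hz : z ≠ 0 := by
    rintro rfl
    rw [norm_zero] at h1
    exact qhalf_ne_zero η (norm_le_zero_iff.1 h1)
  have hc := differentiable_qPochInf hq
  have hi : DifferentiableAt ℂ (fun z : ℂ => z⁻¹) z := differentiableAt_inv hz
  have hcomp : ∀ g : ℂ → ℂ, DifferentiableAt ℂ g z →
      DifferentiableAt ℂ (fun z => qPochInf (g z) (qbase η)) z := fun g hg =>
    (hc (g z)).comp z hg
  unfold shiftedWeight
  refine DifferentiableAt.div ?_ ?_ ?_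
  · refine (hi.sub differentiableAt_id).mul ((hcomp _ ?_).mul (hcomp _ ?_))
    · fun_prop
    · exact (hi.pow 2).const_mul _
  · refine DifferentiableAt.fun_finsetProd fun j _ => (hcomp _ ?_).mul (hcomp _ ?_)
    · fun_prop
    · exact (hi.const_mul _).const_mul _
  · refine Finset.prod_ne_zero_iff.2 fun j _ => mul_ne_zero ?_ ?_ <;> apply qPochInf_ne_zero hq <;>
      rw [norm_mul]
    · refine mul_lt_one_of_nonneg_of_lt_one_left (norm_nonneg _) (ha j) ?_
      rw [norm_mul]
      exact mul_le_one₀ hh.le (norm_nonneg _) h2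
    · refine mul_lt_one_of_nonneg_of_lt_one_left (norm_nonneg _) (ha j) ?_
      rw [norm_mul, norm_inv, ← div_eq_mul_inv]
      exact div_le_one_of_le₀ h1 (norm_nonneg _)

/-! ### The lattice -/

lemma xOf_inv (z : ℂ) : xOf z⁻¹ = xOf z := by simp only [xOf, inv_inv]; ring

lemma xOf_sub_xOf {z w : ℂ} (hz : z ≠ 0) (hw : w ≠ 0) :
    xOf z - xOf w = (z - w) * (z * w - 1) / (2 * z * w) := by
  simp only [xOf]; field_simp; ring

lemma xOf_exp_mul_I (θ : ℝ) : xOf (Complex.exp (θ * Complex.I)) = (Real.cos θ : ℂ) := by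
  rw [xOf, ← Complex.exp_neg, Complex.ofReal_cos, Complex.cos]; ring_nf

lemma exists_xOf_eq_of_mem_Icc {t : ℝ} (ht : t ∈ Set.Icc (-1 : ℝ) 1) :
    ∃ u : ℂ, ‖u‖ = 1 ∧ xOf u = t :=
  ⟨Complex.exp (Real.arccos t * Complex.I), Complex.norm_exp_ofReal_mul_I _, by
    rw [xOf_exp_mul_I, Real.cos_arccos ht.1 ht.2]⟩

lemma xOf_ne_of_norm {z u : ℂ} (hz : 1 < ‖z‖) (hu : ‖u‖ = 1) : xOf z ≠ xOf u := by
  have hz0 : z ≠ 0 := by rintro rfl; simp at hz; linarith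
  have hu0 : u ≠ 0 := by rintro rfl; simp at hu
  rw [← sub_ne_zero, xOf_sub_xOf hz0 hu0]
  refine div_ne_zero (mul_ne_zero ?_ ?_) (by simp [hz0, hu0])
  · rw [sub_ne_zero]; rintro rfl; linarith
  · rw [sub_ne_zero]; intro h
    have := congrArg norm h
    rw [norm_mul, hu] at this
    simp at this
    linarith

lemma xOf_ne_of_mem_Icc {z : ℂ} (hz : 1 < ‖z‖) {t : ℝ} (ht : t ∈ Set.Icc (-1 : ℝ) 1) :
    xOf z ≠ t := by
  obtain ⟨u, hu, hut⟩ := exists_xOf_eq_of_mem_Icc ht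
  rw [← hut]
  exact xOf_ne_of_norm hz hu

/-! ### The difference equation of the Stieltjes function -/

/-- The partial fraction decomposition, in the variable `x(u)`, of the adjoint of the first order
difference operator applied to the Cauchy kernel. -/
lemma cauchy_kernel_partial_fractions {h u z s1 s2 s3 s4 : ℂ} (h0 : h ≠ 0) (hh : h ^ 2 - 1 ≠ 0)
    (u0 : u ≠ 0) (z0 : z ≠ 0) (hz : z ^ 2 - 1 ≠ 0) (e1 : z - h * u ≠ 0) (e2 : z * u - h ≠ 0)
    (e3 : h * z - u ≠ 0) (e4 : h * z * u - 1 ≠ 0) (D : ℂ → ℂ)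
    (hD : ∀ w, w ≠ 0 → D w = 1 / w ^ 2 - s1 / h / w + s2 / h ^ 2 - s3 / h ^ 3 * w
      + s4 / h ^ 4 * w ^ 2) :
    D (h * u) / (xOf z - xOf (h * u)) - D (h * u⁻¹) / (xOf z - xOf (h * u⁻¹)) =
      (u - u⁻¹) * ((h - h⁻¹) / 2 *
        ((D z / (xOf (h⁻¹ * z) - xOf u) - D z⁻¹ / (xOf (h * z) - xOf u)) /
            ((h - h⁻¹) * (z - z⁻¹) / 2)
          - 4 * (s4 / h ^ 3 - 1 / h) / (h - h⁻¹))) := by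
  have hu' : u⁻¹ ≠ 0 := inv_ne_zero u0
  rw [xOf_sub_xOf z0 (mul_ne_zero h0 u0), xOf_sub_xOf z0 (mul_ne_zero h0 hu'),
    xOf_sub_xOf (mul_ne_zero (inv_ne_zero h0) z0) u0, xOf_sub_xOf (mul_ne_zero h0 z0) u0,
    hD _ (mul_ne_zero h0 u0), hD _ (mul_ne_zero h0 hu'), hD z z0, hD _ (inv_ne_zero z0)]
  have r1 : z - h * u⁻¹ = (z * u - h) / u := by field_simp
  have r2 : z * (h * u⁻¹) - 1 = (h * z - u) / u := by field_simp
  have r3 : h⁻¹ * z - u = (z - h * u) / h := by field_simp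
  have r4 : h⁻¹ * z * u - 1 = (z * u - h) / h := by field_simp
  have r5 : h - h⁻¹ = (h ^ 2 - 1) / h := by field_simp
  have r6 : z - z⁻¹ = (z ^ 2 - 1) / z := by field_simp
  have r7 : z * (h * u) - 1 = h * z * u - 1 := by ring
  rw [r1, r2, r3, r4, r5, r6, r7]
  clear r1 r2 r3 r4 r5 r6 r7 hD
  -- The factors of the denominators become atoms so that clearing denominators does not expand
  -- them; they are restored for the final polynomial identity.
  generalize hE1 : z - h * u = E1 at *
  generalize hE2 : z * u - h = E2 at *
  generalize hE3 : h * z - u = E3 at *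
  generalize hE4 : h * z * u - 1 = E4 at *
  generalize hE5 : h ^ 2 - 1 = E5 at *
  generalize hE6 : z ^ 2 - 1 = E6 at *
  field_simp
  subst hE1 hE2 hE3 hE4 hE5 hE6
  ring

lemma integral_Icc_eq_integral_cos {g : ℝ → ℂ} (hg : ContinuousOn g (Set.Icc (-1) 1)) :
    ∫ x in (-1 : ℝ)..1, g x = ∫ θ in (0 : ℝ)..Real.pi, (Real.sin θ : ℂ) * g (Real.cos θ) := by
  have h := intervalIntegral.integral_deriv_smul_comp'' (a := 0) (b := Real.pi) (f := Real.cos)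
    (f' := fun θ => -Real.sin θ) (g := g) Real.continuous_cos.continuousOn
    (fun x _ => (Real.hasDerivAt_cos x).hasDerivWithinAt)
    Real.continuous_sin.neg.continuousOn
    (hg.mono (by rintro _ ⟨θ, _, rfl⟩; exact ⟨Real.neg_one_le_cos θ, Real.cos_le_one θ⟩))
  rw [Real.cos_zero, Real.cos_pi] at h
  rw [intervalIntegral.integral_symm, ← h, ← intervalIntegral.integral_neg]
  refine intervalIntegral.integral_congr fun θ _ => ?_
  simp

lemma one_lt_norm_of_one_lt_norm_qhalf_mul {η : ℂ} (hη : 0 < η.im) {z : ℂ}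
    (hz : 1 < ‖qhalf η * z‖) : 1 < ‖z‖ ∧ 1 < ‖(qhalf η)⁻¹ * z‖ := by
  have h1 := norm_qhalf_lt_one hη
  have h0 : 0 < ‖qhalf η‖ := norm_pos_iff.2 (qhalf_ne_zero η)
  rw [norm_mul] at hz ⊢
  have hz1 : 1 < ‖z‖ := by nlinarith [norm_nonneg z]
  refine ⟨hz1, ?_⟩
  rw [norm_inv]
  have : 1 < ‖qhalf η‖⁻¹ := (one_lt_inv₀ h0).2 h1
  nlinarith

lemma integrable_weight_mul {η : ℂ} (hη : 0 < η.im) {a : Fin 4 → ℂ} (ha : ∀ j, ‖a j‖ < 1)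
    {g : ℝ → ℂ} (hg : ContinuousOn g (Set.Icc (-1) 1)) :
    IntervalIntegrable (fun x => weight η a x * g x) MeasureTheory.volume (-1) 1 := by
  apply ContinuousOn.intervalIntegrable
  rw [Set.uIcc_of_le (by norm_num)]
  exact (weight_continuous hη ha).continuousOn.mul hg

lemma continuousOn_inv_sub {X : ℂ} (hX : ∀ t : ℝ, t ∈ Set.Icc (-1 : ℝ) 1 → X ≠ t) :
    ContinuousOn (fun t : ℝ => (X - t)⁻¹) (Set.Icc (-1) 1) := by
  refine ContinuousOn.inv₀ (by fun_prop) fun t ht => sub_ne_zero.2 (hX t ht)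

/-- The constant in the inhomogeneous first order difference equation of the Stieltjes function
of the normalized weight. -/
def stieltjesConst (η : ℂ) (a : Fin 4 → ℂ) : ℂ :=
  4 * (sig a 4 / qhalf η ^ 3 - 1 / qhalf η) / (qhalf η - (qhalf η)⁻¹)

/-- The combination of Cauchy kernels annihilated by the weight. -/
def pearsonKernel (η : ℂ) (a : Fin 4 → ℂ) (z x : ℂ) : ℂ :=
  (qhalf η - (qhalf η)⁻¹) / 2 *
    ((dataPlus η a z * (yMinus η z - x)⁻¹ - dataMinus η a z * (yPlus η z - x)⁻¹) / deltaY η z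
      - stieltjesConst η a)

open Complex in
lemma integral_weight_mul_pearsonKernel {η : ℂ} (hη : 0 < η.im) {a : Fin 4 → ℂ}
    (ha : ∀ j, ‖a j‖ < 1) {z : ℂ} (hz : 1 < ‖qhalf η * z‖) :
    ∫ x in (-1 : ℝ)..1, weight η a x * pearsonKernel η a z x = 0 := by
  obtain ⟨hz1, hz2⟩ := one_lt_norm_of_one_lt_norm_qhalf_mul hη hz
  have h0 := qhalf_ne_zero η
  have hh := norm_qhalf_lt_one hη
  have z0 : z ≠ 0 := by rintro rfl; simp at hz1; linarith
  -- The kernel has its poles at $w=z^{\pm1}$. The condition $|q^{1/2}z|>1$ puts both outside the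
  -- annulus $|q^{1/2}|\le|w|\le1$.
  set H : ℂ → ℂ := fun w => shiftedWeight η a w * (xOf z - xOf w)⁻¹ with hH
  have hHd : ∀ w, ‖qhalf η‖ ≤ ‖w‖ → ‖w‖ ≤ 1 → DifferentiableAt ℂ H w := by
    intro w hw1 hw2
    have hw0 : w ≠ 0 := by
      rintro rfl
      rw [norm_zero] at hw1
      exact h0 (norm_le_zero_iff.1 hw1)
    refine (differentiableAt_shiftedWeight hη ha hw1 hw2).mul (DifferentiableAt.inv ?_ ?_)
    · unfold xOf
      exact (differentiableAt_const _).sub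
        ((differentiableAt_id.add (differentiableAt_inv hw0)).div_const _)
    · rw [xOf_sub_xOf z0 hw0]
      refine div_ne_zero (mul_ne_zero ?_ ?_) (by simp [z0, hw0])
      · rw [sub_ne_zero]; rintro rfl; linarith
      · rw [sub_ne_zero]; intro h
        have h2 := congrArg norm h
        rw [norm_mul] at h2 hz
        simp only [norm_one] at h2
        nlinarith [norm_nonneg z]
  have hHa : ∀ w, H w⁻¹ = -H w := fun w => by
    simp only [hH, xOf_inv, shiftedWeight_inv, neg_mul]
  have hcirc : ∀ c : ℂ, ‖qhalf η‖ ≤ ‖c‖ → ‖c‖ ≤ 1 →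
      Continuous fun θ : ℝ => H (c * exp (θ * I)) := by
    intro c hc1 hc2
    refine continuous_iff_continuousAt.2 fun θ => ?_
    have hn : ‖c * exp (θ * I)‖ = ‖c‖ := by rw [norm_mul, norm_exp_ofReal_mul_I, mul_one]
    exact ContinuousAt.comp (f := fun θ : ℝ => c * exp (θ * I))
      (hHd _ (hn ▸ hc1) (hn ▸ hc2)).continuousAt (by fun_prop)
  -- The contour moves to the unit circle, where oddness of `H` makes the integral zero.
  have hint : ∫ θ in (0 : ℝ)..2 * Real.pi, H (qhalf η * exp (θ * I)) = 0 := by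
    rw [integral_circle_shift h0 hh.le hHd]
    refine integral_circle_eq_zero_of_antisymm ?_ hHa
    simpa using hcirc 1 (by simpa using hh.le) (by simp)
  rw [integral_circle_eq_add (g := fun u => H (qhalf η * u)) (hcirc _ le_rfl hh.le)] at hint
  have hcont : ContinuousOn (fun x : ℝ => pearsonKernel η a z x) (Set.Icc (-1) 1) := by
    have c1 := continuousOn_inv_sub fun t ht => xOf_ne_of_mem_Icc hz ht
    have c2 := continuousOn_inv_sub fun t ht => xOf_ne_of_mem_Icc hz2 ht
    exact continuousOn_const.mul ((((continuousOn_const.mul c2).sub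
      (continuousOn_const.mul c1)).div_const _).sub continuousOn_const)
  rw [integral_Icc_eq_integral_cos (g := fun x => weight η a x * pearsonKernel η a z x)
    ((weight_continuous hη ha).continuousOn.mul hcont)]
  -- With $u=e^{i\theta}$, the values of `H` at $q^{1/2}u$ and $q^{1/2}u^{-1}$ both contain $w(u)$
  -- by the Pearson relation. What multiplies it is the left side of the partial fraction identity,
  -- whose factor $u-u^{-1}$ becomes the Jacobian $\sin\theta$.
  have hpt : ∀ θ ∈ Set.uIcc (0 : ℝ) Real.pi,
      (Real.sin θ : ℂ) * (weight η a (Real.cos θ) * pearsonKernel η a z (Real.cos θ)) =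
        -(1 / qhalf η) * (H (qhalf η * exp (θ * I)) + H (qhalf η * (exp (θ * I))⁻¹)) := by
    intro θ hθ
    rw [Set.uIcc_of_le Real.pi_pos.le] at hθ
    rw [← xOf_exp_mul_I, weight, Real.arccos_cos hθ.1 hθ.2, mul_comm I]
    have hsin : (Real.sin θ : ℂ) = (exp (θ * I) - (exp (θ * I))⁻¹) / (2 * I) := by
      rw [← exp_neg, ofReal_sin, Complex.sin]
      rw [div_eq_div_iff two_ne_zero (by simp)]
      ring_nf
      rw [I_sq]; ring
    rw [hsin]
    have hu : ‖exp (θ * I)‖ = 1 := norm_exp_ofReal_mul_I _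
    have u0 : exp (θ * I) ≠ 0 := exp_ne_zero _
    generalize exp (θ * I) = u at hu u0
    have hne : ∀ w : ℂ, ‖w‖ = 1 → ∀ j, 1 - a j * (qhalf η)⁻¹ * (qhalf η * w) ≠ 0 := by
      intro w hw j h
      have h1 : a j * w = 1 := by
        have : a j * (qhalf η)⁻¹ * (qhalf η * w) = a j * w := by field_simp
        linear_combination -h - this
      have h2 := congrArg norm h1
      rw [norm_mul, hw, mul_one, norm_one] at h2
      exact (ha j).ne h2
    have w1 := dataPlus_mul_weightZ hη a (mul_ne_zero h0 u0) (hne u hu)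
    have w2 := dataPlus_mul_weightZ hη a (mul_ne_zero h0 (inv_ne_zero u0))
      (hne u⁻¹ (by simp [hu]))
    rw [inv_mul_cancel_left₀ h0] at w1 w2
    rw [weightZ_inv] at w2
    have pf := cauchy_kernel_partial_fractions (h := qhalf η) (u := u) (z := z) h0
      (sub_ne_zero.2 (qhalf_sq_ne_one hη)) u0 z0
      (fun h => by
        have h2 := congrArg norm (sub_eq_zero.1 h)
        rw [norm_pow, norm_one] at h2
        nlinarith)
      (fun h => by
        have h2 := congrArg norm (sub_eq_zero.1 h)
        rw [norm_mul, hu] at h2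
        linarith)
      (fun h => by
        have h2 := congrArg norm (sub_eq_zero.1 h)
        rw [norm_mul, hu] at h2
        linarith)
      (fun h => by
        have h2 := congrArg norm (sub_eq_zero.1 h)
        rw [hu] at h2
        linarith)
      (fun h => by
        have h2 := congrArg norm (sub_eq_zero.1 h)
        rw [norm_mul, hu, norm_one] at h2
        linarith)
      (dataPlus η a) (fun w hw => dataPlus_expand hη a hw)
    rw [← dataMinus_eq_dataPlus_inv, ← deltaY_eq] at pf
    have pf' : dataPlus η a (qhalf η * u) * (xOf z - xOf (qhalf η * u))⁻¹ -
        dataPlus η a (qhalf η * u⁻¹) * (xOf z - xOf (qhalf η * u⁻¹))⁻¹ =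
        (u - u⁻¹) * pearsonKernel η a z (xOf u) := pf
    have hI := I_ne_zero
    calc (u - u⁻¹) / (2 * I) * (weightZ η a u * pearsonKernel η a z (xOf u))
        = weightZ η a u * ((u - u⁻¹) * pearsonKernel η a z (xOf u)) / (2 * I) := by ring
      _ = (dataPlus η a (qhalf η * u) * weightZ η a u * (xOf z - xOf (qhalf η * u))⁻¹ +
          dataPlus η a (qhalf η * u⁻¹) * (-weightZ η a u) *
            (xOf z - xOf (qhalf η * u⁻¹))⁻¹) / (2 * I) := by rw [← pf']; ring
      _ = _ := by rw [w1, w2]; simp only [hH]; field_simp; ring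
  rw [intervalIntegral.integral_congr hpt, intervalIntegral.integral_const_mul, hint, mul_zero]

lemma deltaY_ne_zero {η : ℂ} (hη : 0 < η.im) {z : ℂ} (hz : 1 < ‖z‖) : deltaY η z ≠ 0 := by
  have z0 : z ≠ 0 := by rintro rfl; simp at hz; linarith
  rw [deltaY_eq]
  refine div_ne_zero (mul_ne_zero (qhalf_sub_inv_ne_zero hη) fun h => ?_) two_ne_zero
  have h2 : z ^ 2 = 1 := by field_simp at h; linear_combination h
  have h3 := congrArg norm h2
  rw [norm_pow, norm_one] at h3
  nlinarith

/-- The first order inhomogeneous difference equation of the Stieltjes function. -/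
theorem stieltjes_difference_equation {η : ℂ} (hη : 0 < η.im) {a : Fin 4 → ℂ}
    (ha : ∀ j, ‖a j‖ < 1) {z : ℂ} (hz : 1 < ‖qhalf η * z‖) :
    dataPlus η a z * stieltjes η a (yMinus η z) - dataMinus η a z * stieltjes η a (yPlus η z) =
      deltaY η z * (stieltjesConst η a * dIntegral η (weight η a)) := by
  obtain ⟨hz1, hz2⟩ := one_lt_norm_of_one_lt_norm_qhalf_mul hη hz
  have hk := qhalf_sub_inv_ne_zero hη
  have hd := deltaY_ne_zero hη hz1
  have c1 := integrable_weight_mul hη ha (continuousOn_inv_sub fun t ht => xOf_ne_of_mem_Icc hz ht)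
  have c2 := integrable_weight_mul hη ha (continuousOn_inv_sub fun t ht => xOf_ne_of_mem_Icc hz2 ht)
  have c0 : IntervalIntegrable (weight η a) MeasureTheory.volume (-1) 1 :=
    (weight_continuous hη ha).intervalIntegrable _ _
  have key := integral_weight_mul_pearsonKernel hη ha hz
  have e : ∀ x : ℝ, weight η a x * pearsonKernel η a z x = (qhalf η - (qhalf η)⁻¹) / 2 *
      ((dataPlus η a z * (weight η a x * (xOf ((qhalf η)⁻¹ * z) - x)⁻¹)
        - dataMinus η a z * (weight η a x * (xOf (qhalf η * z) - x)⁻¹)) / deltaY η z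
        - stieltjesConst η a * weight η a x) := fun x => by
    rw [pearsonKernel, yPlus, yMinus]; ring
  simp only [e] at key
  rw [intervalIntegral.integral_const_mul, intervalIntegral.integral_sub
    (((c2.const_mul _).sub (c1.const_mul _)).div_const _) (c0.const_mul _),
    intervalIntegral.integral_div, intervalIntegral.integral_sub (c2.const_mul _) (c1.const_mul _),
    intervalIntegral.integral_const_mul, intervalIntegral.integral_const_mul,
    intervalIntegral.integral_const_mul] at key
  have key2 := (mul_eq_zero.1 key).resolve_left (div_ne_zero hk two_ne_zero)
  rw [sub_eq_zero, div_eq_iff hd] at key2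
  simp only [stieltjes, dIntegral, div_eq_mul_inv (weight η a _), yPlus, yMinus]
  linear_combination (Complex.sin η / η) * key2

/-! ### Orthonormal polynomials for a linear functional -/

section Orthonormal

variable {L : ℂ[X] →ₗ[ℂ] ℂ} {p : ℕ → ℂ[X]}

lemma coeff_eq_zero_of_degree_eq (hdeg : ∀ n, (p n).degree = n) {n k : ℕ} (h : n < k) :
    (p n).coeff k = 0 :=
  coeff_eq_zero_of_degree_lt (by rw [hdeg]; exact_mod_cast h)

lemma gam_ne_zero (hdeg : ∀ n, (p n).degree = n) (n : ℕ) : gam p n ≠ 0 :=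
  coeff_ne_zero_of_eq_degree (hdeg n)

/-- Downward reduction of the degree: subtracting a multiple of $p_m$ with $m<n$ removes the leading
term of `S` without changing the pairing with $p_n$. -/
lemma functional_mul_eq_zero (hdeg : ∀ n, (p n).degree = n)
    (horth : ∀ n m, L (p n * p m) = if n = m then 1 else 0) {n : ℕ} {S : ℂ[X]}
    (hS : S.degree < n) : L (p n * S) = 0 := by
  suffices H : ∀ m ≤ n, ∀ S : ℂ[X], S.degree < m → L (p n * S) = 0 from H n le_rfl S hS
  intro m
  induction m with
  | zero =>
    intro _ S hS
    have : S = 0 := by simpa using hS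
    simp [this]
  | succ m ih =>
    intro hm S hS
    have hR : (S - C (S.coeff m / gam p m) * p m).degree < m := by
      rw [degree_lt_iff_coeff_zero]
      intro k hk
      rw [coeff_sub, coeff_C_mul]
      rcases eq_or_lt_of_le hk with rfl | hk
      · have := gam_ne_zero hdeg m
        rw [gam] at *
        field_simp
        ring
      · rw [coeff_eq_zero_of_degree_eq hdeg hk, coeff_eq_zero_of_degree_lt]
        · simp
        · exact hS.trans_le (by exact_mod_cast hk)
    have h1 := ih (by omega) _ hR
    have h2 : p n * (S - C (S.coeff m / gam p m) * p m) =
        p n * S - (S.coeff m / gam p m) • (p n * p m) := by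
      rw [smul_eq_C_mul]; ring
    rw [h2, map_sub, map_smul, horth, if_neg (by omega), smul_zero, sub_zero] at h1
    exact h1

/-- In $L(p_n^2)=1$ only the leading term of one factor contributes. This is the first non-zero
moment of $p_n$, hence the leading coefficient of $q_n$. -/
lemma functional_mul_X_pow_self (hdeg : ∀ n, (p n).degree = n)
    (horth : ∀ n m, L (p n * p m) = if n = m then 1 else 0) (n : ℕ) :
    L (p n * X ^ n) = 1 / gam p n := by
  have hR : (p n - C (gam p n) * X ^ n).degree < (n : WithBot ℕ) := by
    rw [degree_lt_iff_coeff_zero]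
    intro k hk
    rw [coeff_sub, coeff_C_mul, coeff_X_pow]
    rcases eq_or_lt_of_le hk with rfl | hk
    · simp [gam]
    · rw [coeff_eq_zero_of_degree_eq hdeg hk, if_neg (by omega)]; simp
  have h1 := functional_mul_eq_zero hdeg horth hR
  have h2 : p n * (p n - C (gam p n) * X ^ n) = p n * p n - gam p n • (p n * X ^ n) := by
    rw [smul_eq_C_mul]; ring
  rw [h2, map_sub, map_smul, horth, if_pos rfl, smul_eq_mul] at h1
  rw [eq_div_iff (gam_ne_zero hdeg n)]
  linear_combination -h1

/-- Expand $L(p_np_{n+1})=0$: only the two top terms of $p_{n+1}$ survive. This moment gives the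
second term of $q_n$ at infinity. -/
lemma functional_mul_X_pow_succ (hdeg : ∀ n, (p n).degree = n)
    (horth : ∀ n m, L (p n * p m) = if n = m then 1 else 0) (n : ℕ) :
    L (p n * X ^ (n + 1)) = -(gamSub p (n + 1) / gam p (n + 1)) / gam p n := by
  have hR : (p (n + 1) - C (gam p (n + 1)) * X ^ (n + 1) - C (gamSub p (n + 1)) * X ^ n).degree
      < (n : WithBot ℕ) := by
    rw [degree_lt_iff_coeff_zero]
    intro k hk
    rw [coeff_sub, coeff_sub, coeff_C_mul, coeff_X_pow, coeff_C_mul, coeff_X_pow]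
    rcases eq_or_lt_of_le hk with rfl | hk
    · simp [gamSub]
    · rcases eq_or_lt_of_le (Nat.succ_le_of_lt hk) with rfl | hk'
      · simp [gam]
      · rw [coeff_eq_zero_of_degree_eq hdeg hk', if_neg (by omega), if_neg (by omega)]; simp
  have h1 := functional_mul_eq_zero hdeg horth hR
  have h2 : p n * (p (n + 1) - C (gam p (n + 1)) * X ^ (n + 1) - C (gamSub p (n + 1)) * X ^ n) =
      p n * p (n + 1) - gam p (n + 1) • (p n * X ^ (n + 1)) -
        gamSub p (n + 1) • (p n * X ^ n) := by
    rw [smul_eq_C_mul, smul_eq_C_mul]; ring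
  rw [h2, map_sub, map_sub, map_smul, map_smul, horth, if_neg (by omega),
    functional_mul_X_pow_self hdeg horth, smul_eq_mul, smul_eq_mul] at h1
  have g1 := gam_ne_zero hdeg n
  have g2 := gam_ne_zero hdeg (n + 1)
  field_simp at h1 ⊢
  linear_combination -h1

/-- Non-degeneracy without positivity, as the weight is complex: pairing `R` with the $p_m$ of the
same degree returns the leading coefficient divided by $\gamma_m$. -/
lemma eq_zero_of_functional_mul_eq_zero (hdeg : ∀ n, (p n).degree = n)
    (horth : ∀ n m, L (p n * p m) = if n = m then 1 else 0) {n : ℕ} {R : ℂ[X]}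
    (hR : R.degree < n) (h : ∀ m < n, L (p m * R) = 0) : R = 0 := by
  by_contra h0
  have hd : R.natDegree < n := (natDegree_lt_iff_degree_lt h0).2 hR
  have h1 := h _ hd
  have hS : (R - C R.leadingCoeff * X ^ R.natDegree).degree < (R.natDegree : WithBot ℕ) := by
    rw [degree_lt_iff_coeff_zero]
    intro k hk
    rw [coeff_sub, coeff_C_mul, coeff_X_pow]
    rcases eq_or_lt_of_le hk with rfl | hk
    · simp
    · rw [coeff_eq_zero_of_natDegree_lt hk, if_neg (by omega)]; simp
  have h2 := functional_mul_eq_zero hdeg horth hS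
  have h3 : p R.natDegree * (R - C R.leadingCoeff * X ^ R.natDegree) =
      p R.natDegree * R - R.leadingCoeff • (p R.natDegree * X ^ R.natDegree) := by
    rw [smul_eq_C_mul]; ring
  rw [h3, map_sub, map_smul, h1, functional_mul_X_pow_self hdeg horth, smul_eq_mul, zero_sub,
    neg_eq_zero, mul_eq_zero] at h2
  exact h2.elim (leadingCoeff_ne_zero.2 h0) (one_div_ne_zero (gam_ne_zero hdeg _))

/-- The three-term recurrence. -/
theorem three_term_recurrence (hdeg : ∀ n, (p n).degree = n)
    (horth : ∀ n m, L (p n * p m) = if n = m then 1 else 0) (n : ℕ) :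
    C (recA p 0 (n + 1)) * p (n + 1) =
      (X - C (recB p n)) * p n - C (recA p 0 n) * pPrev p n := by
  rw [← sub_eq_zero]
  have g1 := gam_ne_zero hdeg n
  have g2 := gam_ne_zero hdeg (n + 1)
  -- The definitions of $a_{n+1}$ and $b_n$ are what cancels the coefficients of $x^{n+1}$ and
  -- $x^n$; it remains to test against $p_m$ with $m<n$.
  refine eq_zero_of_functional_mul_eq_zero hdeg horth (n := n) ?_ ?_
  · rw [degree_lt_iff_coeff_zero]
    intro k hk
    have hprev : (C (recA p 0 n) * pPrev p n).coeff k = 0 := by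
      rw [coeff_C_mul]
      cases n with
      | zero => simp [recA]
      | succ n => rw [pPrev, coeff_eq_zero_of_degree_eq hdeg (by omega), mul_zero]
    rw [coeff_sub, coeff_sub, hprev, sub_mul, coeff_sub, coeff_C_mul, coeff_C_mul]
    have hX : (X * p n).coeff k = if k = 0 then 0 else (p n).coeff (k - 1) := by
      cases k with
      | zero => simp
      | succ k => simp [coeff_X_mul]
    rw [hX]
    simp only [recA, recB]
    rcases eq_or_lt_of_le hk with rfl | hk
    · have : (if n = 0 then 0 else (p n).coeff (n - 1)) = gamSub p n := by
        cases n <;> simp [gamSub]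
      rw [this]
      have e1 : (p n).coeff n = gam p n := rfl
      have e2 : (p (n + 1)).coeff n = gamSub p (n + 1) := rfl
      rw [e1, e2]
      field_simp
      ring
    · rw [if_neg (by omega), coeff_eq_zero_of_degree_eq hdeg hk]
      rcases eq_or_lt_of_le (Nat.succ_le_of_lt hk) with rfl | hk'
      · have e1 : (p n).coeff (n.succ - 1) = gam p n := rfl
        have e2 : (p (n + 1)).coeff n.succ = gam p (n + 1) := rfl
        rw [e1, e2]
        field_simp
        ring
      · rw [coeff_eq_zero_of_degree_eq hdeg hk', coeff_eq_zero_of_degree_eq hdeg (by omega)]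
        simp
  · intro m hm
    have e : p m * (C (recA p 0 (n + 1)) * p (n + 1) -
        ((X - C (recB p n)) * p n - C (recA p 0 n) * pPrev p n)) =
        recA p 0 (n + 1) • (p m * p (n + 1)) - p n * (X * p m) + recB p n • (p m * p n)
          + recA p 0 n • (p m * pPrev p n) := by
      simp only [smul_eq_C_mul]; ring
    rw [e, map_add, map_add, map_sub, map_smul, map_smul, map_smul, horth, horth,
      if_neg (by omega), if_neg (by omega), smul_zero, smul_zero]
    obtain ⟨n, rfl⟩ : ∃ k, n = k + 1 := ⟨n - 1, by omega⟩
    rw [pPrev, horth]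
    -- Only the neighbouring index matters: there $xp_m$ has component $\gamma_m/\gamma_{m+1}$ along
    -- $p_{m+1}$. For smaller $m$ its degree is too low to meet the tested polynomial.
    rcases eq_or_lt_of_le (Nat.lt_succ_iff.1 hm) with rfl | hm'
    · have hR : (X * p m - C (gam p m / gam p (m + 1)) * p (m + 1)).degree <
          ((m + 1 : ℕ) : WithBot ℕ) := by
        rw [degree_lt_iff_coeff_zero]
        intro k hk
        obtain ⟨k, rfl⟩ : ∃ j, k = j + 1 := ⟨k - 1, by omega⟩
        rw [coeff_sub, coeff_C_mul, coeff_X_mul]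
        rcases eq_or_lt_of_le hk with hk | hk
        · obtain rfl : m = k := by omega
          have e1 : (p m).coeff m = gam p m := rfl
          have e2 : (p (m + 1)).coeff (m + 1) = gam p (m + 1) := rfl
          rw [e1, e2]
          field_simp
          ring
        · rw [coeff_eq_zero_of_degree_eq hdeg hk, coeff_eq_zero_of_degree_eq hdeg (by omega)]
          simp
      have h1 := functional_mul_eq_zero hdeg horth hR
      have h2 : p (m + 1) * (X * p m - C (gam p m / gam p (m + 1)) * p (m + 1)) =
          p (m + 1) * (X * p m) - (gam p m / gam p (m + 1)) • (p (m + 1) * p (m + 1)) := by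
        rw [smul_eq_C_mul]; ring
      rw [h2, map_sub, map_smul, horth, if_pos rfl, smul_eq_mul, mul_one] at h1
      rw [if_pos rfl]
      simp only [recA, smul_eq_mul]
      linear_combination -h1
    · rw [if_neg (by omega), functional_mul_eq_zero hdeg horth]
      · simp
      · rw [degree_mul, degree_X, hdeg]
        norm_cast
        omega

end Orthonormal

/-! ### The functional of the weight and its Cauchy transform -/

lemma continuousOn_eval (P : ℂ[X]) (s : Set ℝ) :
    ContinuousOn (fun t : ℝ => P.eval (t : ℂ)) s :=
  (P.continuous.comp Complex.continuous_ofReal).continuousOn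

/-- Integration against the Askey–Wilson weight, as a linear functional on polynomials. -/
def weightFunctional {η : ℂ} (hη : 0 < η.im) {a : Fin 4 → ℂ} (ha : ∀ j, ‖a j‖ < 1) :
    ℂ[X] →ₗ[ℂ] ℂ where
  toFun P := dIntegral η fun x => weight η a x * P.eval (x : ℂ)
  map_add' P Q := by
    simp only [dIntegral, eval_add, mul_add]
    rw [intervalIntegral.integral_add (integrable_weight_mul hη ha (continuousOn_eval P _))
      (integrable_weight_mul hη ha (continuousOn_eval Q _)), mul_add]
  map_smul' c P := by
    simp only [dIntegral, eval_smul, smul_eq_mul, RingHom.id_apply, mul_left_comm _ c]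
    rw [intervalIntegral.integral_const_mul]; ring

/-- The Cauchy transform of `w P`. -/
def cauchyTransform (η : ℂ) (a : Fin 4 → ℂ) (P : ℂ[X]) (x : ℂ) : ℂ :=
  dIntegral η fun y => weight η a y * (P.eval (y : ℂ) * (x - y)⁻¹)

/-- `x` lies off the cut `[-1, 1]`. -/
def OffCut (x : ℂ) : Prop := ∀ t : ℝ, t ∈ Set.Icc (-1 : ℝ) 1 → x ≠ t

lemma offCut_of_one_lt_norm {x : ℂ} (hx : 1 < ‖x‖) : OffCut x := by
  rintro t ht rfl
  rw [Complex.norm_real, Real.norm_eq_abs] at hx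
  exact absurd (abs_le.2 ht) (not_le.2 hx)

section Cauchy

variable {η : ℂ} (hη : 0 < η.im) {a : Fin 4 → ℂ} (ha : ∀ j, ‖a j‖ < 1)

include hη ha

lemma integrable_cauchyTransform (P : ℂ[X]) {x : ℂ} (hx : OffCut x) :
    IntervalIntegrable (fun y : ℝ => weight η a y * (P.eval (y : ℂ) * (x - y)⁻¹))
      MeasureTheory.volume (-1) 1 :=
  integrable_weight_mul hη ha ((continuousOn_eval P _).mul (continuousOn_inv_sub hx))

lemma cauchyTransform_add (P Q : ℂ[X]) {x : ℂ} (hx : OffCut x) :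
    cauchyTransform η a (P + Q) x = cauchyTransform η a P x + cauchyTransform η a Q x := by
  simp only [cauchyTransform, dIntegral, eval_add, add_mul, mul_add]
  rw [intervalIntegral.integral_add (integrable_cauchyTransform hη ha P hx)
    (integrable_cauchyTransform hη ha Q hx), mul_add]

/-- Integrated form of $x/(x-y)=1+y/(x-y)$. Iterated, it produces the moment expansion at infinity.
-/
lemma mul_cauchyTransform (P : ℂ[X]) {x : ℂ} (hx : OffCut x) :
    x * cauchyTransform η a P x = weightFunctional hη ha P + cauchyTransform η a (X * P) x := by
  simp only [cauchyTransform, dIntegral, weightFunctional, LinearMap.coe_mk, AddHom.coe_mk]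
  rw [← mul_add, ← intervalIntegral.integral_add
    (integrable_weight_mul hη ha (continuousOn_eval P _))
    (integrable_cauchyTransform hη ha (X * P) hx), mul_left_comm,
    ← intervalIntegral.integral_const_mul]
  congr 1
  refine intervalIntegral.integral_congr fun t ht => ?_
  rw [Set.uIcc_of_le (by norm_num)] at ht
  have h := sub_ne_zero.2 (hx t ht)
  simp only [eval_mul, eval_X]
  field_simp
  ring

/-- The terms with $p_n(x)$ in $fp_n$ and in the associated polynomial cancel. -/
lemma qFun_eq_cauchyTransform (p : ℕ → ℂ[X]) (n : ℕ) {x : ℂ} (hx : OffCut x) :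
    qFun η a p n x = cauchyTransform η a (p n) x := by
  simp only [qFun, stieltjes, assocPrev, cauchyTransform, dIntegral]
  have h1 : ∀ y : ℝ, weight η a y / (x - y) = weight η a y * (x - y)⁻¹ := fun y => rfl
  have h2 : ∀ y ∈ Set.uIcc (-1 : ℝ) 1,
      weight η a y * (((p n).eval (y : ℂ) - (p n).eval x) / ((y : ℂ) - x)) =
      weight η a y * (x - y)⁻¹ * (p n).eval x - weight η a y * ((p n).eval (y : ℂ) * (x - y)⁻¹) := by
    intro y hy
    rw [Set.uIcc_of_le (by norm_num)] at hy
    have h := sub_ne_zero.2 (hx y hy)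
    have h' := sub_ne_zero.2 (hx y hy).symm
    rw [← neg_sub x, div_neg]
    field_simp
    ring
  simp only [h1]
  rw [intervalIntegral.integral_congr h2, intervalIntegral.integral_sub
    ((integrable_weight_mul hη ha (continuousOn_inv_sub hx)).mul_const _)
    (integrable_cauchyTransform hη ha (p n) hx), intervalIntegral.integral_mul_const]
  ring

/-- The Cauchy transform of `w P` is `f P` up to a polynomial. -/
lemma exists_cauchyTransform_eq (P : ℂ[X]) : ∃ A : ℂ[X], ∀ x, OffCut x →
    cauchyTransform η a P x = stieltjes η a x * P.eval x - A.eval x := by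
  have hC : ∀ c : ℂ, ∃ A : ℂ[X], ∀ x, OffCut x →
      cauchyTransform η a (C c) x = stieltjes η a x * (C c).eval x - A.eval x := by
    intro c
    refine ⟨0, fun x _ => ?_⟩
    simp only [cauchyTransform, stieltjes, dIntegral, eval_C, eval_zero, sub_zero]
    rw [mul_assoc, ← intervalIntegral.integral_mul_const]
    congr 1
    refine intervalIntegral.integral_congr fun t _ => ?_
    simp only [div_eq_mul_inv]
    ring
  induction P using Polynomial.induction_on with
  | C c => exact hC c
  | add P Q hP hQ =>
    obtain ⟨A, hA⟩ := hP
    obtain ⟨B, hB⟩ := hQ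
    refine ⟨A + B, fun x hx => ?_⟩
    rw [cauchyTransform_add hη ha _ _ hx, hA x hx, hB x hx, eval_add, eval_add]
    ring
  | monomial n c hP =>
    obtain ⟨A, hA⟩ := hP
    -- Raising the power by one multiplies the polynomial part by $x$ and adds the moment from
    -- `mul_cauchyTransform`.
    refine ⟨X * A + C (weightFunctional hη ha (C c * X ^ n)), fun x hx => ?_⟩
    have h := mul_cauchyTransform hη ha (C c * X ^ n) hx
    rw [show C c * X ^ (n + 1) = X * (C c * X ^ n) by ring]
    rw [hA x hx] at h
    simp only [eval_mul, eval_X, eval_add, eval_C] at h ⊢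
    linear_combination -h

/-- The numerator is bounded on the cut, and $|x-t|\ge|x|-1$ there. -/
lemma tendsto_cauchyTransform (P : ℂ[X]) :
    Filter.Tendsto (cauchyTransform η a P) (Bornology.cobounded ℂ) (nhds 0) := by
  obtain ⟨C, hC⟩ := (isCompact_Icc (a := (-1 : ℝ)) (b := 1)).exists_bound_of_continuousOn
    ((weight_continuous hη ha).continuousOn.mul (continuousOn_eval P _))
  have hlim : Filter.Tendsto (fun x : ℂ => ‖Complex.sin η / η‖ * (C * (‖x‖ - 1)⁻¹ * 2))
      (Bornology.cobounded ℂ) (nhds 0) := by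
    have h1 : Filter.Tendsto (fun x : ℂ => (‖x‖ - 1)⁻¹) (Bornology.cobounded ℂ) (nhds 0) :=
      (Filter.tendsto_atTop_add_const_right _ (-1)
        tendsto_norm_cobounded_atTop).inv_tendsto_atTop
    simpa using ((h1.const_mul C).mul_const 2).const_mul ‖Complex.sin η / η‖
  refine squeeze_zero_norm' ?_ hlim
  filter_upwards [tendsto_norm_cobounded_atTop.eventually_gt_atTop 1] with x hx
  rw [cauchyTransform, dIntegral, norm_mul]
  refine mul_le_mul_of_nonneg_left ?_ (norm_nonneg _)
  have hb := intervalIntegral.norm_integral_le_of_norm_le_const (a := (-1 : ℝ)) (b := 1)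
    (f := fun y : ℝ => weight η a y * (P.eval (y : ℂ) * (x - y)⁻¹)) (C := C * (‖x‖ - 1)⁻¹)
    (fun t ht => ?_)
  · refine hb.trans (le_of_eq ?_)
    norm_num
  · rw [Set.uIoc_of_le (by norm_num)] at ht
    have ht' : t ∈ Set.Icc (-1 : ℝ) 1 := ⟨ht.1.le, ht.2⟩
    rw [← mul_assoc, norm_mul, norm_inv]
    have h1 := hC t ht'
    have h2 : ‖x‖ - 1 ≤ ‖x - t‖ := by
      have := norm_sub_norm_le x (t : ℂ)
      rw [Complex.norm_real, Real.norm_eq_abs] at this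
      have := abs_le.2 ht'
      linarith
    have h3 : ‖x - t‖⁻¹ ≤ (‖x‖ - 1)⁻¹ := inv_anti₀ (by linarith) h2
    exact mul_le_mul h1 h3 (inv_nonneg.2 (norm_nonneg _)) ((norm_nonneg _).trans h1)

end Cauchy

/-! ### First order expansions at infinity -/

/-- `g z = c₀ + c₁ / z + o(1 / z)` as `z → ∞`. -/
def HasExpansion (g : ℂ → ℂ) (c₀ c₁ : ℂ) : Prop :=
  Filter.Tendsto (fun z => z * (g z - c₀)) (Bornology.cobounded ℂ) (nhds c₁)

namespace HasExpansion

variable {f g : ℂ → ℂ} {c₀ c₁ d₀ d₁ : ℂ}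

lemma eventually_ne_zero : ∀ᶠ z : ℂ in Bornology.cobounded ℂ, z ≠ 0 := by
  filter_upwards [tendsto_norm_cobounded_atTop.eventually_gt_atTop 0] with z hz
  exact norm_pos_iff.1 hz

lemma congr (h : HasExpansion f c₀ c₁) (hfg : f =ᶠ[Bornology.cobounded ℂ] g) :
    HasExpansion g c₀ c₁ :=
  Filter.Tendsto.congr' (hfg.mono fun z hz => by simp only [hz]) h

lemma tendsto (h : HasExpansion f c₀ c₁) :
    Filter.Tendsto f (Bornology.cobounded ℂ) (nhds c₀) := by
  have h1 := ((Filter.tendsto_inv₀_cobounded (α := ℂ)).mul h).add_const c₀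
  rw [zero_mul, zero_add] at h1
  refine h1.congr' ?_
  filter_upwards [eventually_ne_zero] with z hz
  field_simp
  ring

lemma const (c : ℂ) : HasExpansion (fun _ => c) c 0 := by
  simp [HasExpansion]

lemma add (hf : HasExpansion f c₀ c₁) (hg : HasExpansion g d₀ d₁) :
    HasExpansion (fun z => f z + g z) (c₀ + d₀) (c₁ + d₁) := by
  refine (Filter.Tendsto.add hf hg).congr fun z => ?_
  ring

lemma mul (hf : HasExpansion f c₀ c₁) (hg : HasExpansion g d₀ d₁) :
    HasExpansion (fun z => f z * g z) (c₀ * d₀) (c₁ * d₀ + c₀ * d₁) := by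
  refine ((Filter.Tendsto.mul hf hg.tendsto).add (Filter.Tendsto.const_mul c₀ hg)).congr
    fun z => ?_
  ring

lemma const_mul (c : ℂ) (hf : HasExpansion f c₀ c₁) :
    HasExpansion (fun z => c * f z) (c * c₀) (c * c₁) := by
  simpa using (const c).mul hf

lemma sub (hf : HasExpansion f c₀ c₁) (hg : HasExpansion g d₀ d₁) :
    HasExpansion (fun z => f z - g z) (c₀ - d₀) (c₁ - d₁) := by
  refine (Filter.Tendsto.sub hf hg).congr fun z => ?_
  ring

lemma pow (hf : HasExpansion f c₀ 0) (n : ℕ) : HasExpansion (fun z => f z ^ n) (c₀ ^ n) 0 := by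
  induction n with
  | zero => simpa using const 1
  | succ n ih => simpa [pow_succ] using ih.mul hf

lemma inv (hf : HasExpansion f c₀ 0) (h0 : c₀ ≠ 0) : HasExpansion (fun z => (f z)⁻¹) c₀⁻¹ 0 := by
  have h1 := (Filter.Tendsto.mul hf (hf.tendsto.inv₀ h0)).mul_const (-c₀⁻¹)
  simp only [zero_mul] at h1
  refine h1.congr' ?_
  filter_upwards [hf.tendsto.eventually_ne h0] with z hz
  field_simp
  ring

lemma unique (hf : HasExpansion f c₀ c₁) (hf' : HasExpansion f d₀ d₁) : c₀ = d₀ ∧ c₁ = d₁ := by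
  obtain rfl := tendsto_nhds_unique hf.tendsto hf'.tendsto
  exact ⟨rfl, tendsto_nhds_unique hf hf'⟩

lemma eval_inv (R : ℂ[X]) : HasExpansion (fun z => R.eval z⁻¹) (R.coeff 0) (R.coeff 1) := by
  have h1 : Filter.Tendsto (fun z : ℂ => (R.divX).eval z⁻¹) (Bornology.cobounded ℂ)
      (nhds ((R.divX).eval 0)) :=
    (R.divX.continuous.tendsto 0).comp Filter.tendsto_inv₀_cobounded
  rw [← coeff_zero_eq_eval_zero, coeff_divX, zero_add] at h1
  refine h1.congr' ?_
  filter_upwards [eventually_ne_zero] with z hz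
  conv_rhs => rw [← divX_mul_X_add R]
  simp only [eval_add, eval_mul, eval_X, eval_C, coeff_add, coeff_C_zero, mul_coeff_zero,
    coeff_X_zero, mul_zero, zero_add]
  field_simp
  ring

lemma eval_div_pow {P : ℂ[X]} {n : ℕ} (hP : P.natDegree ≤ n) :
    HasExpansion (fun z => P.eval z / z ^ n) (P.coeff n) (if n = 0 then 0 else P.coeff (n - 1)) := by
  have h := eval_inv (reflect n P)
  rw [coeff_reflect, coeff_reflect] at h
  -- For $n=0$ the index $1$ is not reflected, and the coefficient there is zero by the degree
  -- bound.
  have e : (if n = 0 then 0 else P.coeff (n - 1)) = P.coeff (revAt n 1) := by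
    rcases n with _ | n
    · rw [if_pos rfl]
      exact (coeff_eq_zero_of_natDegree_lt (by simp [revAt]; omega)).symm
    · rw [revAt_le (by omega), if_neg (by omega)]
  rw [e]
  rw [revAt_le (Nat.zero_le n), Nat.sub_zero] at h
  refine h.congr ?_
  filter_upwards [eventually_ne_zero] with z hz
  let _ := invertibleOfNonzero hz
  have := eval₂_reflect_mul_pow (RingHom.id ℂ) z n P hP
  rw [invOf_eq_inv] at this
  rw [eq_div_iff (pow_ne_zero _ hz)]
  exact this

/-- Only $1/y\sim k/z$ is needed, so a substitution rescales the second coefficient and keeps the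
first. -/
lemma comp {y : ℂ → ℂ} {k : ℂ} (hf : HasExpansion f c₀ c₁)
    (hy : Filter.Tendsto y (Bornology.cobounded ℂ) (Bornology.cobounded ℂ))
    (hk : Filter.Tendsto (fun z => z / y z) (Bornology.cobounded ℂ) (nhds k)) :
    HasExpansion (fun z => f (y z)) c₀ (k * c₁) := by
  refine (hk.mul (Filter.Tendsto.comp hf hy)).congr' ?_
  filter_upwards [hy.eventually eventually_ne_zero] with z hz
  simp only [Function.comp]
  field_simp

lemma inv_sq : HasExpansion (fun z => (z ^ 2)⁻¹) 0 0 := by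
  have h := eval_inv (X ^ 2 : ℂ[X])
  simpa [coeff_X_pow] using h

end HasExpansion

lemma hasExpansion_xOf_div {c : ℂ} (hc : c ≠ 0) :
    HasExpansion (fun z => xOf (c * z) / z) (c / 2) 0 := by
  have h := (HasExpansion.const (c / 2)).add (HasExpansion.inv_sq.const_mul (c⁻¹ / 2))
  simp only [mul_zero, add_zero] at h
  refine h.congr ?_
  filter_upwards [HasExpansion.eventually_ne_zero] with z hz
  rw [xOf]
  field_simp

lemma hasExpansion_div_xOf {c : ℂ} (hc : c ≠ 0) :
    HasExpansion (fun z => z / xOf (c * z)) (2 / c) 0 := by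
  have h := (hasExpansion_xOf_div hc).inv (div_ne_zero hc two_ne_zero)
  simpa using h

lemma tendsto_xOf_cobounded {c : ℂ} (hc : c ≠ 0) :
    Filter.Tendsto (fun z => xOf (c * z)) (Bornology.cobounded ℂ) (Bornology.cobounded ℂ) := by
  rw [← tendsto_norm_atTop_iff_cobounded]
  have h := (hasExpansion_xOf_div hc).tendsto.norm
  refine (tendsto_norm_cobounded_atTop.atTop_mul_pos
    (norm_pos_iff.2 (div_ne_zero hc two_ne_zero)) h).congr' ?_
  filter_upwards [HasExpansion.eventually_ne_zero] with z hz
  rw [← norm_mul]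
  congr 1
  field_simp

lemma HasExpansion.comp_xOf {f : ℂ → ℂ} {c₀ c₁ c : ℂ} (hf : HasExpansion f c₀ c₁) (hc : c ≠ 0) :
    HasExpansion (fun z => f (xOf (c * z))) c₀ (2 / c * c₁) :=
  hf.comp (tendsto_xOf_cobounded hc) (hasExpansion_div_xOf hc).tendsto

/-! ### Expansions of the orthonormal polynomials and of the functions of the second kind -/

lemma IsOPS.functional {η : ℂ} {a : Fin 4 → ℂ} {p : ℕ → ℂ[X]} (hp : IsOPS η a p) (hη : 0 < η.im)
    (ha : ∀ j, ‖a j‖ < 1) (n m : ℕ) :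
    weightFunctional hη ha (p n * p m) = if n = m then 1 else 0 := by
  rw [← hp.orthonormal n m]
  simp [weightFunctional]

lemma IsOPS.gam_ne_zero {η : ℂ} {a : Fin 4 → ℂ} {p : ℕ → ℂ[X]} (hp : IsOPS η a p) (n : ℕ) :
    gam p n ≠ 0 := AskeyWilson.gam_ne_zero hp.degree_eq n

lemma IsOPS.recA_ne_zero {η : ℂ} {a : Fin 4 → ℂ} {p : ℕ → ℂ[X]} (hp : IsOPS η a p) {a₀ : ℂ}
    (ha₀ : a₀ ≠ 0) (n : ℕ) : recA p a₀ n ≠ 0 := by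
  cases n with
  | zero => exact ha₀
  | succ n => exact div_ne_zero (hp.gam_ne_zero _) (hp.gam_ne_zero _)

section OPS

variable {η : ℂ} (hη : 0 < η.im) {a : Fin 4 → ℂ} (ha : ∀ j, ‖a j‖ < 1) {p : ℕ → ℂ[X]}
  (hp : IsOPS η a p)

include hp in
lemma hasExpansion_poly (n : ℕ) :
    HasExpansion (fun x => (p n).eval x / x ^ n) (gam p n) (gamSub p n) := by
  have h := HasExpansion.eval_div_pow (natDegree_le_of_degree_le (hp.degree_eq n).le)
  cases n <;> exact h

-- Two applications of `mul_cauchyTransform` extract two moments; the remainder is a Cauchy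
-- transform, which tends to zero.
include hη ha in
lemma hasExpansion_cauchyTransform (P : ℂ[X]) :
    HasExpansion (fun x => x * cauchyTransform η a P x) (weightFunctional hη ha P)
      (weightFunctional hη ha (X * P)) := by
  have h1 := (tendsto_cauchyTransform hη ha (X * (X * P))).const_add
    (weightFunctional hη ha (X * P))
  rw [add_zero] at h1
  refine h1.congr' ?_
  filter_upwards [tendsto_norm_cobounded_atTop.eventually_gt_atTop 1] with x hx
  have hx := offCut_of_one_lt_norm hx
  rw [mul_cauchyTransform hη ha P hx, add_sub_cancel_left, mul_cauchyTransform hη ha (X * P) hx]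

include hη ha hp

/-- Each multiplication by $x$ would add the moment $L(x^kp_n)$, which vanishes for $k<n$. -/
lemma pow_mul_qFun (n : ℕ) {x : ℂ} (hx : OffCut x) :
    x ^ n * qFun η a p n x = cauchyTransform η a (X ^ n * p n) x := by
  suffices H : ∀ k ≤ n, x ^ k * qFun η a p n x = cauchyTransform η a (X ^ k * p n) x from
    H n le_rfl
  intro k
  induction k with
  | zero => intro _; simp [qFun_eq_cauchyTransform hη ha p n hx]
  | succ k ih =>
    intro hk
    rw [pow_succ', mul_assoc, ih (by omega), mul_cauchyTransform hη ha _ hx,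
      mul_comm (X ^ k), functional_mul_eq_zero hp.degree_eq (hp.functional hη ha)
        (by rw [degree_X_pow]; exact_mod_cast hk), zero_add]
    congr 1
    ring

lemma hasExpansion_qFun (n : ℕ) :
    HasExpansion (fun x => x ^ (n + 1) * qFun η a p n x) (1 / gam p n)
      (-(gamSub p (n + 1) / gam p (n + 1)) / gam p n) := by
  have h := hasExpansion_cauchyTransform hη ha (X ^ n * p n)
  rw [show X * (X ^ n * p n) = p n * X ^ (n + 1) by ring, mul_comm (X ^ n) (p n),
    functional_mul_X_pow_self hp.degree_eq (hp.functional hη ha),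
    functional_mul_X_pow_succ hp.degree_eq (hp.functional hη ha)] at h
  refine h.congr ?_
  filter_upwards [tendsto_norm_cobounded_atTop.eventually_gt_atTop 1] with x hx
  rw [mul_comm (p n), ← pow_mul_qFun hη ha hp n (offCut_of_one_lt_norm hx)]
  ring

/-- The factor $a_n$ replaces $\gamma_{n-1}$ by $\gamma_n$. The convention $q_{-1}=1/(a_0\gamma_0)$
is what lets $n=0$ obey the same formula. -/
lemma hasExpansion_qFunPrev {a₀ : ℂ} (ha₀ : a₀ ≠ 0) (n : ℕ) :
    HasExpansion (fun x => recA p a₀ n * (x ^ n * qFunPrev η a p a₀ n x)) (1 / gam p n)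
      (-(gamSub p n / gam p n) / gam p n) := by
  cases n with
  | zero =>
    have h := HasExpansion.const (1 / gam p 0)
    have := hp.gam_ne_zero 0
    simp only [recA, qFunPrev, gamSub, zero_div, neg_zero, pow_zero, one_mul]
    refine h.congr (Filter.Eventually.of_forall fun x => ?_)
    field_simp
  | succ n =>
    have h := (hasExpansion_qFun hη ha hp n).const_mul (recA p a₀ (n + 1))
    have g1 := hp.gam_ne_zero n
    have g2 := hp.gam_ne_zero (n + 1)
    have e1 : recA p a₀ (n + 1) * (1 / gam p n) = 1 / gam p (n + 1) := by
      simp only [recA]; field_simp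
    have e2 : recA p a₀ (n + 1) * (-(gamSub p (n + 1) / gam p (n + 1)) / gam p n) =
        -(gamSub p (n + 1) / gam p (n + 1)) / gam p (n + 1) := by
      simp only [recA]; field_simp
    rw [e1, e2] at h
    exact h

/-- Expansion of `a_n p_n(y) q_{n-1}(y')` for `y = x(c z)` and `y' = x(c' z)`. -/
lemma hasExpansion_poly_mul_qFunPrev {a₀ : ℂ} (ha₀ : a₀ ≠ 0) (n : ℕ) {c c' : ℂ} (hc : c ≠ 0)
    (hc' : c' ≠ 0) :
    HasExpansion (fun z => recA p a₀ n *
        ((p n).eval (xOf (c * z)) * qFunPrev η a p a₀ n (xOf (c' * z))))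
      ((c / c') ^ n) ((c / c') ^ n * (gamSub p n / gam p n * (2 / c - 2 / c'))) := by
  have h1 := ((hasExpansion_poly hp n).comp_xOf hc).mul ((hasExpansion_xOf_div hc).pow n)
  have h2 := ((hasExpansion_qFunPrev hη ha hp ha₀ n).comp_xOf hc').mul
    ((hasExpansion_div_xOf hc').pow n)
  have h := h1.mul h2
  have g := hp.gam_ne_zero n
  have e : (c / c') ^ n = (c / 2) ^ n * (2 / c') ^ n := by
    rw [← mul_pow]; congr 1; field_simp
  have e0 : gam p n * (c / 2) ^ n * (1 / gam p n * (2 / c') ^ n) = (c / c') ^ n := by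
    rw [e]; field_simp
  rw [e0] at h
  convert h.congr ?_ using 1
  · rw [e]; field_simp; ring
  · filter_upwards [(tendsto_xOf_cobounded hc).eventually HasExpansion.eventually_ne_zero,
      (tendsto_xOf_cobounded hc').eventually HasExpansion.eventually_ne_zero,
      HasExpansion.eventually_ne_zero] with z h1 h2 h3
    rw [div_pow, div_pow]
    generalize xOf (c * z) = y at *
    generalize xOf (c' * z) = y' at *
    field_simp

/-- `p_{n-1}(y) q_n(y')` is of order `z⁻²` for `y = x(c z)` and `y' = x(c' z)`. -/
lemma hasExpansion_pPrev_mul_qFun (n : ℕ) {c c' : ℂ} (hc : c ≠ 0) (hc' : c' ≠ 0) :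
    HasExpansion (fun z => (pPrev p n).eval (xOf (c * z)) * qFun η a p n (xOf (c' * z))) 0 0 := by
  cases n with
  | zero => simpa [pPrev] using HasExpansion.const 0
  | succ n =>
    have h1 := ((hasExpansion_poly hp n).comp_xOf hc).mul ((hasExpansion_xOf_div hc).pow n)
    have h2 := ((hasExpansion_qFun hη ha hp (n + 1)).comp_xOf hc').mul
      ((hasExpansion_div_xOf hc').pow (n + 2))
    have h := (h1.mul h2).mul HasExpansion.inv_sq
    simp only [mul_zero, add_zero] at h
    refine h.congr ?_
    filter_upwards [(tendsto_xOf_cobounded hc).eventually HasExpansion.eventually_ne_zero,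
      (tendsto_xOf_cobounded hc').eventually HasExpansion.eventually_ne_zero,
      HasExpansion.eventually_ne_zero] with z h1 h2 h3
    rw [div_pow, div_pow, pPrev]
    generalize xOf (c * z) = y at *
    generalize xOf (c' * z) = y' at *
    field_simp
    ring

/-- The leading behaviour of `p_n(y) q_n(y')` for `y = x(c z)` and `y' = x(c' z)`. -/
lemma tendsto_mul_poly_mul_qFun (n : ℕ) {c c' : ℂ} (hc : c ≠ 0) (hc' : c' ≠ 0) :
    Filter.Tendsto (fun z => z * ((p n).eval (xOf (c * z)) * qFun η a p n (xOf (c' * z))))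
      (Bornology.cobounded ℂ) (nhds ((c / c') ^ n * (2 / c'))) := by
  have h1 := ((hasExpansion_poly hp n).comp_xOf hc).mul ((hasExpansion_xOf_div hc).pow n)
  have h2 := ((hasExpansion_qFun hη ha hp n).comp_xOf hc').mul
    ((hasExpansion_div_xOf hc').pow (n + 1))
  have h := (h1.mul h2).tendsto
  have g := hp.gam_ne_zero n
  have e : gam p n * (c / 2) ^ n * (1 / gam p n * (2 / c') ^ (n + 1)) =
      (c / c') ^ n * (2 / c') := by
    have : (c / c') ^ n = (c / 2) ^ n * (2 / c') ^ n := by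
      rw [← mul_pow]; congr 1; field_simp
    rw [this, pow_succ (2 / c')]; field_simp
  rw [e] at h
  refine h.congr' ?_
  filter_upwards [(tendsto_xOf_cobounded hc).eventually HasExpansion.eventually_ne_zero,
    (tendsto_xOf_cobounded hc').eventually HasExpansion.eventually_ne_zero,
    HasExpansion.eventually_ne_zero] with z h1 h2 h3
  rw [div_pow, div_pow]
  generalize xOf (c * z) = y at *
  generalize xOf (c' * z) = y' at *
  field_simp
  ring

end OPS

lemma hasExpansion_dataPlus {η : ℂ} (hη : 0 < η.im) (a : Fin 4 → ℂ) :
    HasExpansion (fun z => dataPlus η a z / z ^ 2) (sig a 4 / qhalf η ^ 4)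
      (-(sig a 3 / qhalf η ^ 3)) := by
  have h := HasExpansion.eval_inv (X ^ 4 - C (sig a 1 / qhalf η) * X ^ 3 +
    C (sig a 2 / qhalf η ^ 2) * X ^ 2 - C (sig a 3 / qhalf η ^ 3) * X + C (sig a 4 / qhalf η ^ 4))
  simp [coeff_X, coeff_C] at h
  refine h.congr ?_
  filter_upwards [HasExpansion.eventually_ne_zero] with z hz
  rw [dataPlus_expand hη a hz]
  field_simp

lemma hasExpansion_dataMinus {η : ℂ} (hη : 0 < η.im) (a : Fin 4 → ℂ) :
    HasExpansion (fun z => dataMinus η a z / z ^ 2) 1 (-(sig a 1 / qhalf η)) := by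
  have h := HasExpansion.eval_inv (C (sig a 4 / qhalf η ^ 4) * X ^ 4
    - C (sig a 3 / qhalf η ^ 3) * X ^ 3 +
    C (sig a 2 / qhalf η ^ 2) * X ^ 2 - C (sig a 1 / qhalf η) * X + 1)
  simp [coeff_X, coeff_one] at h
  refine h.congr ?_
  filter_upwards [HasExpansion.eventually_ne_zero] with z hz
  rw [dataMinus_eq_dataPlus_inv, dataPlus_expand hη a (inv_ne_zero hz)]
  have h0 := qhalf_ne_zero η
  field_simp
  ring

/-! ### Laurent polynomials with an inversion symmetry -/

/-- `F` agrees with a Laurent polynomial on `z ≠ 0`. -/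
def IsLaurent (F : ℂ → ℂ) : Prop :=
  ∃ (N : ℕ) (P : ℂ[X]), ∀ z, z ≠ 0 → z ^ N * F z = P.eval z

namespace IsLaurent

variable {F G : ℂ → ℂ}

lemma const (c : ℂ) : IsLaurent fun _ => c := ⟨0, C c, fun z _ => by simp⟩

lemma add (hF : IsLaurent F) (hG : IsLaurent G) : IsLaurent fun z => F z + G z := by
  obtain ⟨N, P, hP⟩ := hF
  obtain ⟨M, Q, hQ⟩ := hG
  refine ⟨N + M, X ^ M * P + X ^ N * Q, fun z hz => ?_⟩
  simp only [eval_add, eval_mul, eval_pow, eval_X, ← hP z hz, ← hQ z hz]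
  ring

lemma mul (hF : IsLaurent F) (hG : IsLaurent G) : IsLaurent fun z => F z * G z := by
  obtain ⟨N, P, hP⟩ := hF
  obtain ⟨M, Q, hQ⟩ := hG
  refine ⟨N + M, P * Q, fun z hz => ?_⟩
  simp only [eval_mul, ← hP z hz, ← hQ z hz]
  ring

lemma const_mul (c : ℂ) (hF : IsLaurent F) : IsLaurent fun z => c * F z := (const c).mul hF

lemma sub (hF : IsLaurent F) (hG : IsLaurent G) : IsLaurent fun z => F z - G z := by
  simpa [sub_eq_add_neg] using hF.add (hG.const_mul (-1))

lemma xOf {c : ℂ} (hc : c ≠ 0) : IsLaurent fun z => xOf (c * z) := by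
  refine ⟨1, C (c / 2) * X ^ 2 + C (c⁻¹ / 2), fun z hz => ?_⟩
  simp only [AskeyWilson.xOf, eval_add, eval_mul, eval_C, eval_pow, eval_X]
  field_simp

lemma eval (hF : IsLaurent F) (P : ℂ[X]) : IsLaurent fun z => P.eval (F z) := by
  induction P using Polynomial.induction_on with
  | C c => simpa using const c
  | add P Q hP hQ => simpa using hP.add hQ
  | monomial n c h => simpa [pow_succ, mul_assoc] using h.mul hF

/-- If the degree were larger, the quotient of `P` by its top power of $z$ would tend both to the
leading coefficient and to zero. -/
lemma natDegree_le {N : ℕ} {P : ℂ[X]} (hP : ∀ z, z ≠ 0 → z ^ N * F z = P.eval z) (m : ℕ)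
    (hlim : Filter.Tendsto (fun z => F z / z ^ (m + 1)) (Bornology.cobounded ℂ) (nhds 0)) :
    P.natDegree ≤ N + m := by
  by_contra! hd
  obtain ⟨k, hk⟩ : ∃ k, P.natDegree = N + (m + 1) + k := ⟨P.natDegree - (N + (m + 1)), by omega⟩
  have h1 := (HasExpansion.eval_div_pow (le_refl P.natDegree)).tendsto
  have hinv : Filter.Tendsto (fun z : ℂ => (z⁻¹) ^ k) (Bornology.cobounded ℂ) (nhds (0 ^ k)) :=
    Filter.tendsto_inv₀_cobounded.pow _
  have h2 := hlim.mul hinv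
  rw [zero_mul] at h2
  have h3 : P.leadingCoeff = 0 := by
    refine tendsto_nhds_unique (h1.congr' ?_) h2
    filter_upwards [HasExpansion.eventually_ne_zero] with z hz
    rw [← hP z hz, hk, pow_add, pow_add, inv_pow]
    field_simp
  rw [leadingCoeff_eq_zero] at h3
  rw [h3, natDegree_zero] at hd
  omega

/-- A Laurent polynomial that is symmetric or antisymmetric under inversion and is `o(z)` at
infinity is constant. -/
lemma exists_eq_const (hF : IsLaurent F) {ε : ℂ} (hsymm : ∀ z, z ≠ 0 → F z⁻¹ = ε * F z)
    (hlim : Filter.Tendsto (fun z => F z / z) (Bornology.cobounded ℂ) (nhds 0)) :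
    ∃ β, ∀ z, z ≠ 0 → F z = β := by
  obtain ⟨N, P, hP⟩ := hF
  have hdeg : P.natDegree ≤ N := natDegree_le hP 0 (by simpa using hlim)
  -- Inversion symmetry of $F=z^{-N}P$ says that the coefficients are symmetric about index $N$ up
  -- to `ε`; two inversions give $\varepsilon^2F=F$.
  have hrefl : P = C ε * reflect (2 * N) P := by
    refine Polynomial.eq_of_infinite_eval_eq _ _
      ((Set.finite_singleton (0 : ℂ)).infinite_compl.mono ?_)
    intro z hz
    have hz : z ≠ 0 := hz
    let _ := invertibleOfNonzero (inv_ne_zero hz)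
    have h1 := eval₂_reflect_mul_pow (RingHom.id ℂ) z⁻¹ (2 * N) P (by omega)
    rw [invOf_eq_inv, inv_inv] at h1
    have h1 : (reflect (2 * N) P).eval z * z⁻¹ ^ (2 * N) = P.eval z⁻¹ := h1
    have h2 := hP z⁻¹ (inv_ne_zero hz)
    rw [hsymm z hz, ← h1] at h2
    have h3 := hP z hz
    have hε : ε * ε * F z = F z := by
      rw [mul_assoc, ← hsymm z hz, ← hsymm _ (inv_ne_zero hz), inv_inv]
    simp only [Set.mem_ofPred_eq, eval_mul, eval_C]
    rw [← h3]
    have h4 : (reflect (2 * N) P).eval z = z ^ N * (ε * F z) := by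
      rw [show z⁻¹ ^ (2 * N) = z⁻¹ ^ N * z⁻¹ ^ N by rw [two_mul, pow_add]] at h2
      have := pow_ne_zero N hz
      rw [inv_pow] at h2
      field_simp at h2
      linear_combination -h2
    rw [h4]
    linear_combination (-z ^ N) * hε
  -- Growth excludes indices above $N$, and reflection then excludes those below.
  have hmono : P = C (P.coeff N) * X ^ N := by
    ext j
    rw [coeff_C_mul, coeff_X_pow]
    rcases lt_trichotomy j N with hj | rfl | hj
    · rw [if_neg (by omega), hrefl, coeff_C_mul, coeff_reflect, revAt_le (by omega),
        coeff_eq_zero_of_natDegree_lt (by omega)]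
      simp
    · simp
    · rw [coeff_eq_zero_of_natDegree_lt (by omega), if_neg (by omega), mul_zero]
  refine ⟨P.coeff N, fun z hz => ?_⟩
  have h := hP z hz
  rw [hmono] at h
  simp only [eval_mul, eval_C, eval_pow, eval_X] at h
  have := pow_ne_zero N hz
  rw [mul_comm] at h
  exact mul_right_cancel₀ this h

/-- An antisymmetric Laurent polynomial that is `o(z)` at infinity vanishes. -/
lemma eq_zero_of_antisymm (hF : IsLaurent F) (hsymm : ∀ z, z ≠ 0 → F z⁻¹ = -F z)
    (hlim : Filter.Tendsto (fun z => F z / z) (Bornology.cobounded ℂ) (nhds 0)) {z : ℂ}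
    (hz : z ≠ 0) : F z = 0 := by
  obtain ⟨β, hβ⟩ := hF.exists_eq_const (ε := -1) (fun z hz => by rw [hsymm z hz]; ring) hlim
  have h := hsymm 1 one_ne_zero
  rw [inv_one, hβ 1 one_ne_zero] at h
  rw [hβ z hz]
  linear_combination h / 2

/-- A symmetric Laurent polynomial that is `o(z²)` at infinity and vanishes at `±1` vanishes. -/
lemma eq_zero_of_symm (hF : IsLaurent F) (hsymm : ∀ z, z ≠ 0 → F z⁻¹ = F z)
    (hlim : Filter.Tendsto (fun z => F z / z ^ 2) (Bornology.cobounded ℂ) (nhds 0))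
    (h1 : F 1 = 0) (h2 : F (-1) = 0) {z : ℂ} (hz : z ≠ 0) : F z = 0 := by
  -- The growth bound leaves room only for $F=2\alpha x+\beta$; the values at $x=\pm1$ then kill
  -- both constants.
  obtain ⟨α, hα⟩ : ∃ α, Filter.Tendsto (fun z => F z / z) (Bornology.cobounded ℂ) (nhds α) := by
    obtain ⟨N, P, hP⟩ := hF
    have hdeg : P.natDegree ≤ N + 1 := natDegree_le hP 1 hlim
    refine ⟨_, (HasExpansion.eval_div_pow hdeg).tendsto.congr' ?_⟩
    filter_upwards [HasExpansion.eventually_ne_zero] with z hz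
    rw [← hP z hz, pow_succ]
    field_simp
  have hx1 : IsLaurent AskeyWilson.xOf := by simpa using IsLaurent.xOf (c := 1) one_ne_zero
  have hx2 := (hasExpansion_xOf_div (c := 1) one_ne_zero).tendsto
  simp only [one_mul] at hx2
  obtain ⟨β, hβ⟩ := (hF.sub (hx1.const_mul (2 * α))).exists_eq_const (ε := 1)
    (fun z hz => by rw [hsymm z hz, xOf_inv, one_mul]) (by
      have h := hα.sub (hx2.const_mul (2 * α))
      rw [show α - 2 * α * (1 / 2) = 0 by ring] at h
      exact h.congr fun z => by ring)
  have e1 := hβ 1 one_ne_zero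
  have e2 := hβ (-1) (by norm_num)
  have e := hβ z hz
  have x1 : AskeyWilson.xOf 1 = 1 := by norm_num [AskeyWilson.xOf]
  have x2 : AskeyWilson.xOf (-1) = -1 := by norm_num [AskeyWilson.xOf, inv_neg]
  rw [h1, x1] at e1
  rw [h2, x2] at e2
  have hα0 : α = 0 := by linear_combination (e2 - e1) / 4
  have hβ0 : β = 0 := by linear_combination -(e1 + e2) / 2
  rw [hα0, hβ0] at e
  simpa using e

end IsLaurent

lemma isLaurent_deltaY (η : ℂ) : IsLaurent (deltaY η) :=
  (IsLaurent.xOf (qhalf_ne_zero η)).sub (IsLaurent.xOf (inv_ne_zero (qhalf_ne_zero η)))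

lemma isLaurent_dataPlus (η : ℂ) (a : Fin 4 → ℂ) : IsLaurent (dataPlus η a) := by
  have hx : IsLaurent xOf := by simpa using IsLaurent.xOf (c := 1) one_ne_zero
  exact (hx.eval _).add ((isLaurent_deltaY η).mul (hx.eval _))

lemma isLaurent_dataMinus (η : ℂ) (a : Fin 4 → ℂ) : IsLaurent (dataMinus η a) := by
  have hx : IsLaurent xOf := by simpa using IsLaurent.xOf (c := 1) one_ne_zero
  exact (hx.eval _).sub ((isLaurent_deltaY η).mul (hx.eval _))

/-! ### Bilinear forms in solutions of the form `f P - A` -/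

/-- `g = f P - A` off the cut, with `f` the Stieltjes function. -/
def IsSecondKind (η : ℂ) (a : Fin 4 → ℂ) (g : ℂ → ℂ) (P A : ℂ[X]) : Prop :=
  ∀ x, OffCut x → g x = stieltjes η a x * P.eval x - A.eval x

/-- The Laurent polynomial form of
`(W + Δy V) P(y₊) (f Q - B)(y₋) - (W - Δy V) Q(y₋) (f P - A)(y₊)`, where `K` is the
inhomogeneity in the difference equation of `f`. -/
def crossForm (η : ℂ) (a : Fin 4 → ℂ) (K : ℂ) (P A Q B : ℂ[X]) (z : ℂ) : ℂ :=
  deltaY η z * K * (P.eval (yPlus η z) * Q.eval (yMinus η z))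
    - dataPlus η a z * (P.eval (yPlus η z) * B.eval (yMinus η z))
    + dataMinus η a z * (Q.eval (yMinus η z) * A.eval (yPlus η z))

lemma isLaurent_crossForm (η : ℂ) (a : Fin 4 → ℂ) (K : ℂ) (P A Q B : ℂ[X]) :
    IsLaurent (crossForm η a K P A Q B) := by
  have h1 : ∀ P : ℂ[X], IsLaurent fun z => P.eval (yPlus η z) :=
    fun P => (IsLaurent.xOf (qhalf_ne_zero η)).eval P
  have h2 : ∀ P : ℂ[X], IsLaurent fun z => P.eval (yMinus η z) :=
    fun P => (IsLaurent.xOf (inv_ne_zero (qhalf_ne_zero η))).eval P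
  exact ((((isLaurent_deltaY η).mul (IsLaurent.const K)).mul ((h1 P).mul (h2 Q))).sub
    ((isLaurent_dataPlus η a).mul ((h1 P).mul (h2 B)))).add
    ((isLaurent_dataMinus η a).mul ((h2 Q).mul (h1 A)))

lemma yPlus_inv (η z : ℂ) : yPlus η z⁻¹ = yMinus η z := by
  rw [yPlus, yMinus, ← xOf_inv, mul_inv, inv_inv]

lemma yMinus_inv (η z : ℂ) : yMinus η z⁻¹ = yPlus η z := by
  rw [yPlus, yMinus, ← xOf_inv, mul_inv, inv_inv, inv_inv]

lemma deltaY_inv (η z : ℂ) : deltaY η z⁻¹ = -deltaY η z := by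
  rw [deltaY, deltaY, yPlus_inv, yMinus_inv]; ring

lemma dataPlus_inv (η : ℂ) (a : Fin 4 → ℂ) (z : ℂ) : dataPlus η a z⁻¹ = dataMinus η a z :=
  (dataMinus_eq_dataPlus_inv η a z).symm

lemma dataMinus_inv (η : ℂ) (a : Fin 4 → ℂ) (z : ℂ) : dataMinus η a z⁻¹ = dataPlus η a z := by
  rw [dataMinus_eq_dataPlus_inv, inv_inv]

lemma crossForm_inv (η : ℂ) (a : Fin 4 → ℂ) (K : ℂ) (P A Q B : ℂ[X]) (z : ℂ) :
    crossForm η a K P A Q B z⁻¹ = -crossForm η a K Q B P A z := by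
  simp only [crossForm, yPlus_inv, yMinus_inv, deltaY_inv, dataPlus_inv, dataMinus_inv]
  ring

/-- A cross form is $(P,A)(y_+)\,N\,(Q,B)(y_-)^{T}$ with $N$ having rows $(K\Delta y,\,-(W+\Delta
yV))$ and $(W-\Delta yV,\,0)$. The determinant is therefore a product of three determinants, and $K$
disappears. -/
lemma crossForm_det (η : ℂ) (a : Fin 4 → ℂ) (K : ℂ) (P A Q B : ℂ[X]) (z : ℂ) :
    crossForm η a K P A P A z * crossForm η a K Q B Q B z -
      crossForm η a K P A Q B z * crossForm η a K Q B P A z =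
    dataPlus η a z * dataMinus η a z *
      ((Q * A - P * B).eval (yPlus η z) * (Q * A - P * B).eval (yMinus η z)) := by
  simp only [crossForm, eval_sub, eval_mul]
  ring

/-- The terms in $f(y_\pm)$ combine to $P(y_+)Q(y_-)$ times the left side of the difference
equation. -/
lemma crossForm_eq {η : ℂ} (hη : 0 < η.im) {a : Fin 4 → ℂ} (ha : ∀ j, ‖a j‖ < 1)
    {P A Q B : ℂ[X]} {g k : ℂ → ℂ} (hg : IsSecondKind η a g P A) (hk : IsSecondKind η a k Q B)
    {z : ℂ} (hz : 1 < ‖qhalf η * z‖) :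
    crossForm η a (stieltjesConst η a * dIntegral η (weight η a)) P A Q B z =
      dataPlus η a z * (P.eval (yPlus η z) * k (yMinus η z))
        - dataMinus η a z * (Q.eval (yMinus η z) * g (yPlus η z)) := by
  obtain ⟨_, hz2⟩ := one_lt_norm_of_one_lt_norm_qhalf_mul hη hz
  rw [crossForm, hg (yPlus η z) fun t ht => xOf_ne_of_mem_Icc hz ht,
    hk (yMinus η z) fun t ht => xOf_ne_of_mem_Icc hz2 ht]
  linear_combination (-(P.eval (yPlus η z) * Q.eval (yMinus η z))) *
    stieltjes_difference_equation hη ha hz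

lemma eventually_one_lt_norm_qhalf_mul (η : ℂ) :
    ∀ᶠ z : ℂ in Bornology.cobounded ℂ, 1 < ‖qhalf η * z‖ := by
  have h := tendsto_norm_cobounded_atTop (E := ℂ).const_mul_atTop
    (norm_pos_iff.2 (qhalf_ne_zero η))
  filter_upwards [h.eventually_gt_atTop 1] with z hz
  rwa [norm_mul]

/-- The inhomogeneity in the difference equation of the Stieltjes function. -/
def stieltjesInhom (η : ℂ) (a : Fin 4 → ℂ) : ℂ :=
  stieltjesConst η a * dIntegral η (weight η a)

lemma exists_isSecondKind_qFun {η : ℂ} (hη : 0 < η.im) {a : Fin 4 → ℂ} (ha : ∀ j, ‖a j‖ < 1)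
    (p : ℕ → ℂ[X]) (n : ℕ) : ∃ A, IsSecondKind η a (qFun η a p n) (p n) A := by
  obtain ⟨A, hA⟩ := exists_cauchyTransform_eq hη ha (p n)
  exact ⟨A, fun x hx => by rw [qFun_eq_cauchyTransform hη ha p n hx, hA x hx]⟩

lemma exists_isSecondKind_qFunPrev {η : ℂ} (hη : 0 < η.im) {a : Fin 4 → ℂ}
    (ha : ∀ j, ‖a j‖ < 1) (p : ℕ → ℂ[X]) (a₀ : ℂ) (n : ℕ) :
    ∃ B, IsSecondKind η a (qFunPrev η a p a₀ n) (pPrev p n) B := by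
  cases n with
  | zero => exact ⟨C (-(1 / (a₀ * gam p 0))), fun x _ => by simp [qFunPrev, pPrev]⟩
  | succ n => exact exists_isSecondKind_qFun hη ha p n

/-! ### Cross forms of the orthonormal polynomials, determined by symmetry and growth -/

section Spectral

variable {η : ℂ} (hη : 0 < η.im) {a : Fin 4 → ℂ} (ha : ∀ j, ‖a j‖ < 1) {p : ℕ → ℂ[X]}
  (hp : IsOPS η a p) {a₀ : ℂ} (ha₀ : a₀ ≠ 0)

include hη ha hp ha₀ in
/-- The Casoratian of the polynomials and the functions of the second kind. -/
lemma casoratian (n : ℕ) {A B : ℂ[X]} (hA : IsSecondKind η a (qFun η a p n) (p n) A)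
    (hB : IsSecondKind η a (qFunPrev η a p a₀ n) (pPrev p n) B) {z : ℂ} (hz : z ≠ 0) :
    (pPrev p n * A - p n * B).eval (xOf z) = 1 / recA p a₀ n := by
  set G := pPrev p n * A - p n * B with hG
  have hx : IsLaurent xOf := by simpa using IsLaurent.xOf (c := 1) one_ne_zero
  have har := hp.recA_ne_zero ha₀ n
  have h1 := (hasExpansion_poly_mul_qFunPrev hη ha hp ha₀ n (c := 1) (c' := 1) one_ne_zero
    one_ne_zero).tendsto
  have h2 := (hasExpansion_pPrev_mul_qFun hη ha hp n (c := 1) (c' := 1) one_ne_zero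
    one_ne_zero).tendsto
  simp only [div_one, one_pow, one_mul] at h1 h2
  -- In the combination of `A` and `B` the Stieltjes function cancels, so it equals
  -- $p_nq_{n-1}-p_{n-1}q_n$ off the cut. The first product supplies the limit $1/a_n$; the second
  -- decays.
  have hlim : Filter.Tendsto (fun z => G.eval (xOf z)) (Bornology.cobounded ℂ)
      (nhds (1 / recA p a₀ n)) := by
    have h3 := (h1.const_mul (recA p a₀ n)⁻¹).sub h2
    rw [mul_one, sub_zero, ← one_div] at h3
    refine h3.congr' ?_
    have hoff := (tendsto_xOf_cobounded (c := 1) one_ne_zero).eventually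
      (tendsto_norm_cobounded_atTop.eventually_gt_atTop 1)
    filter_upwards [hoff] with z hz
    rw [one_mul] at hz
    have hz := offCut_of_one_lt_norm hz
    rw [hA _ hz, hB _ hz, hG]
    simp only [eval_sub, eval_mul]
    field_simp
    ring
  obtain ⟨β, hβ⟩ := (hx.eval G).exists_eq_const (ε := 1)
    (fun z _ => by rw [xOf_inv, one_mul]) (by
      have h4 := hlim.mul Filter.tendsto_inv₀_cobounded
      rw [mul_zero] at h4
      exact h4)
  rw [hβ z hz]
  refine tendsto_nhds_unique (tendsto_const_nhds.congr' ?_) hlim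
  filter_upwards [HasExpansion.eventually_ne_zero] with z hz
  exact (hβ z hz).symm

/-- `h / h⁻¹` to the power `n` is `qⁿ`. -/
lemma qhalf_div_inv_pow (η : ℂ) (n : ℕ) : (qhalf η / (qhalf η)⁻¹) ^ n = qbase η ^ n := by
  rw [qbase_eq_sq, div_inv_eq_mul, sq]

lemma inv_div_qhalf_pow (η : ℂ) (n : ℕ) : ((qhalf η)⁻¹ / qhalf η) ^ n = (qbase η ^ n)⁻¹ := by
  rw [qbase_eq_sq, ← inv_pow]
  congr 1
  field_simp

lemma hasExpansion_deltaY (η : ℂ) :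
    HasExpansion (fun z => deltaY η z / z) ((qhalf η - (qhalf η)⁻¹) / 2) 0 := by
  have h := (hasExpansion_xOf_div (qhalf_ne_zero η)).sub
    (hasExpansion_xOf_div (inv_ne_zero (qhalf_ne_zero η)))
  rw [← sub_div, sub_zero] at h
  refine h.congr (Filter.Eventually.of_forall fun z => ?_)
  simp only [deltaY, yPlus, yMinus]
  ring

include hη ha hp in
/-- `crossForm` for the pair `(p_n, p_n)` is `Δy Θ_n` with `Θ_n` constant. -/
lemma crossForm_self (n : ℕ) {A : ℂ[X]} (hA : IsSecondKind η a (qFun η a p n) (p n) A) {z : ℂ}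
    (hz : z ≠ 0) :
    crossForm η a (stieltjesInhom η a) (p n) A (p n) A z =
      deltaY η z * (4 * (qbase η ^ n * sig a 4 / qhalf η ^ 3 - (qbase η ^ n)⁻¹ / qhalf η) /
        (qhalf η - (qhalf η)⁻¹)) := by
  have h0 := qhalf_ne_zero η
  have hk := qhalf_sub_inv_ne_zero hη
  rw [← sub_eq_zero]
  set T := 4 * (qbase η ^ n * sig a 4 / qhalf η ^ 3 - (qbase η ^ n)⁻¹ / qhalf η) /
        (qhalf η - (qhalf η)⁻¹) with hT
  refine IsLaurent.eq_zero_of_antisymm (F := fun z =>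
      crossForm η a (stieltjesInhom η a) (p n) A (p n) A z - deltaY η z * T)
    ((isLaurent_crossForm _ _ _ _ _ _ _).sub ((isLaurent_deltaY η).mul (IsLaurent.const T)))
    (fun z _ => by simp only [crossForm_inv, deltaY_inv]; ring) ?_ hz
  have h1 := (hasExpansion_dataPlus hη a).tendsto.mul
    (tendsto_mul_poly_mul_qFun hη ha hp n h0 (inv_ne_zero h0))
  have h2 := (hasExpansion_dataMinus hη a).tendsto.mul
    (tendsto_mul_poly_mul_qFun hη ha hp n (inv_ne_zero h0) h0)
  have h3 := (h1.sub h2).sub ((hasExpansion_deltaY η).tendsto.mul_const T)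
  -- The constant `T` is the value that makes the coefficient of $z$ at infinity cancel, leaving an
  -- odd function that is $o(z)$.
  have e : sig a 4 / qhalf η ^ 4 * ((qhalf η / (qhalf η)⁻¹) ^ n * (2 / (qhalf η)⁻¹)) -
      1 * (((qhalf η)⁻¹ / qhalf η) ^ n * (2 / qhalf η)) - (qhalf η - (qhalf η)⁻¹) / 2 * T = 0 := by
    rw [qhalf_div_inv_pow, inv_div_qhalf_pow, hT]
    generalize qhalf η - (qhalf η)⁻¹ = k at *
    have := pow_ne_zero n (qbase_ne_zero η)
    field_simp
    ring
  rw [e] at h3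
  refine h3.congr' ?_
  filter_upwards [HasExpansion.eventually_ne_zero, eventually_one_lt_norm_qhalf_mul η] with z hz hz'
  rw [stieltjesInhom, crossForm_eq hη ha hA hA hz']
  simp only [yPlus, yMinus]
  field_simp

include hη ha hp ha₀ in
/-- The expansion of `a_n crossForm / z²` for the pair `(p_n, p_{n-1})`. -/
lemma hasExpansion_crossForm_prev (n : ℕ) {A B : ℂ[X]}
    (hA : IsSecondKind η a (qFun η a p n) (p n) A)
    (hB : IsSecondKind η a (qFunPrev η a p a₀ n) (pPrev p n) B) :
    HasExpansion (fun z => recA p a₀ n *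
        crossForm η a (stieltjesInhom η a) (p n) A (pPrev p n) B z / z ^ 2)
      (qbase η ^ n * (sig a 4 / qhalf η ^ 4))
      (qbase η ^ n * (-(sig a 3 / qhalf η ^ 3) - sig a 4 / qhalf η ^ 4 *
        (gamSub p n / gam p n * (2 * (qhalf η - (qhalf η)⁻¹))))) := by
  have h0 := qhalf_ne_zero η
  have h1 := (hasExpansion_dataPlus hη a).mul
    (hasExpansion_poly_mul_qFunPrev hη ha hp ha₀ n h0 (inv_ne_zero h0))
  have h2 := (hasExpansion_dataMinus hη a).mul
    ((hasExpansion_pPrev_mul_qFun hη ha hp n (inv_ne_zero h0) h0).const_mul (recA p a₀ n))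
  have h := h1.sub h2
  rw [qhalf_div_inv_pow] at h
  convert h.congr ?_ using 1
  · ring
  · simp only [div_eq_mul_inv, inv_inv]; ring
  · filter_upwards [HasExpansion.eventually_ne_zero, eventually_one_lt_norm_qhalf_mul η]
      with z hz hz'
    rw [stieltjesInhom, crossForm_eq hη ha hA hB hz']
    simp only [yPlus, yMinus]
    ring

include hη ha hp ha₀ in
/-- The expansion of `a_n crossForm / z²` for the pair `(p_{n-1}, p_n)`. -/
lemma hasExpansion_crossForm_prev' (n : ℕ) {A B : ℂ[X]}
    (hA : IsSecondKind η a (qFun η a p n) (p n) A)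
    (hB : IsSecondKind η a (qFunPrev η a p a₀ n) (pPrev p n) B) :
    HasExpansion (fun z => recA p a₀ n *
        crossForm η a (stieltjesInhom η a) (pPrev p n) B (p n) A z / z ^ 2)
      (-(qbase η ^ n)⁻¹)
      ((qbase η ^ n)⁻¹ * (sig a 1 / qhalf η -
        (gamSub p n / gam p n * (2 * (qhalf η - (qhalf η)⁻¹))))) := by
  have h0 := qhalf_ne_zero η
  have h1 := (hasExpansion_dataMinus hη a).mul
    (hasExpansion_poly_mul_qFunPrev hη ha hp ha₀ n (inv_ne_zero h0) h0)
  have h2 := (hasExpansion_dataPlus hη a).mul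
    ((hasExpansion_pPrev_mul_qFun hη ha hp n h0 (inv_ne_zero h0)).const_mul (recA p a₀ n))
  have h := h2.sub h1
  rw [inv_div_qhalf_pow] at h
  convert h.congr ?_ using 1
  · ring
  · simp only [div_eq_mul_inv, inv_inv]; ring
  · filter_upwards [HasExpansion.eventually_ne_zero, eventually_one_lt_norm_qhalf_mul η]
      with z hz hz'
    rw [stieltjesInhom, crossForm_eq hη ha hB hA hz']
    simp only [yPlus, yMinus]
    ring

/-- The spectral coefficient `W_n`. -/
def spectralW (η : ℂ) (a : Fin 4 → ℂ) (n : ℕ) : ℂ[X] :=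
  C ((1 + (qbase η ^ n)⁻¹) * (1 + sig a 4 * qbase η ^ n / qhalf η ^ 4)) * (X ^ 2 - 1)
    - C (sig a 1 / qhalf η + sig a 3 / qhalf η ^ 3) * X
    + C (1 + sig a 2 / qhalf η ^ 2 + sig a 4 / qhalf η ^ 4)

/-- Expansion of a quadratic polynomial in `x(z)`. -/
lemma hasExpansion_quadratic (A B D : ℂ) :
    HasExpansion (fun z => (A * xOf z ^ 2 + B * xOf z + D) / z ^ 2) (A / 4) (B / 2) := by
  have hx := hasExpansion_xOf_div (c := 1) one_ne_zero
  simp only [one_mul] at hx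
  have hi : HasExpansion (fun z => z⁻¹) 0 1 := by simpa using HasExpansion.eval_inv X
  have h := (((hx.pow 2).const_mul A).add ((hx.mul hi).const_mul B)).add
    (HasExpansion.inv_sq.const_mul D)
  convert h.congr ?_ using 1
  · ring
  · ring
  · exact Filter.Eventually.of_forall fun z => by simp only [div_eq_mul_inv]; ring

lemma eval_spectralW (η : ℂ) (a : Fin 4 → ℂ) (n : ℕ) (x : ℂ) : (spectralW η a n).eval x =
    (1 + (qbase η ^ n)⁻¹) * (1 + sig a 4 * qbase η ^ n / qhalf η ^ 4) * (x ^ 2 - 1)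
      - (sig a 1 / qhalf η + sig a 3 / qhalf η ^ 3) * x
      + (1 + sig a 2 / qhalf η ^ 2 + sig a 4 / qhalf η ^ 4) := by
  simp [spectralW]

lemma hasExpansion_spectralW (η : ℂ) (a : Fin 4 → ℂ) (n : ℕ) :
    HasExpansion
      (fun z => 2 * (2 * (spectralW η a n).eval (xOf z) - (W η a).eval (xOf z)) / z ^ 2)
      ((qbase η ^ n)⁻¹ + sig a 4 / qhalf η ^ 4 * qbase η ^ n)
      (-(sig a 1 / qhalf η + sig a 3 / qhalf η ^ 3)) := by
  have hQ := pow_ne_zero n (qbase_ne_zero η)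
  have h := hasExpansion_quadratic
    (4 * ((1 + (qbase η ^ n)⁻¹) * (1 + sig a 4 * qbase η ^ n / qhalf η ^ 4))
      - 4 * (1 + sig a 4 / qhalf η ^ 4)) (-2 * (sig a 1 / qhalf η + sig a 3 / qhalf η ^ 3))
    (4 * (1 + sig a 2 / qhalf η ^ 2 + sig a 4 / qhalf η ^ 4)
      - 4 * ((1 + (qbase η ^ n)⁻¹) * (1 + sig a 4 * qbase η ^ n / qhalf η ^ 4))
      - 2 * (-1 + sig a 2 / qhalf η ^ 2 - sig a 4 / qhalf η ^ 4))
  convert h.congr ?_ using 1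
  · field_simp; ring
  · ring
  · exact Filter.Eventually.of_forall fun z => by
      simp only [eval_spectralW, eval_W]
      congr 1
      ring

-- The difference of the two cross forms is even in inversion, so its $z^2$-coefficient at infinity
-- and its values at $z=\pm1$ determine it. The unknown $\gamma_{n,1}$, which enters only at order
-- $z$, is not needed.
include hη ha hp ha₀ in
lemma crossForm_sub_eq (n : ℕ) {A B : ℂ[X]} (hA : IsSecondKind η a (qFun η a p n) (p n) A)
    (hB : IsSecondKind η a (qFunPrev η a p a₀ n) (pPrev p n) B) {z : ℂ} (hz : z ≠ 0) :
    recA p a₀ n * (crossForm η a (stieltjesInhom η a) (p n) A (pPrev p n) B z -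
      crossForm η a (stieltjesInhom η a) (pPrev p n) B (p n) A z) =
    2 * (2 * (spectralW η a n).eval (xOf z) - (W η a).eval (xOf z)) := by
  have h0 := qhalf_ne_zero η
  have har := hp.recA_ne_zero ha₀ n
  have hx : IsLaurent xOf := by simpa using IsLaurent.xOf (c := 1) one_ne_zero
  rw [← sub_eq_zero]
  -- At a fixed point of inversion $\Delta y=0$ and $y_+=y_-$, so the forms reduce to $2W$ times the
  -- Casoratian.
  have hend : ∀ s : ℂ, s ≠ 0 → s⁻¹ = s →
      recA p a₀ n * (crossForm η a (stieltjesInhom η a) (p n) A (pPrev p n) B s -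
      crossForm η a (stieltjesInhom η a) (pPrev p n) B (p n) A s) = 2 * (W η a).eval (xOf s) := by
    intro s hs0 hs
    have hd : deltaY η s = 0 := by rw [deltaY_eq, hs]; simp
    have hy : yMinus η s = yPlus η s := by
      rw [deltaY] at hd; linear_combination -hd
    have hc := casoratian hη ha hp ha₀ n hA hB (mul_ne_zero h0 hs0)
    have hc' : (pPrev p n * A - p n * B).eval (yPlus η s) = 1 / recA p a₀ n := hc
    rw [eval_sub, eval_mul, eval_mul, eq_div_iff har] at hc'
    simp only [crossForm, hd, hy, dataPlus, dataMinus]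
    linear_combination 2 * (W η a).eval (xOf s) * hc'
  refine IsLaurent.eq_zero_of_symm (F := fun z => recA p a₀ n *
      (crossForm η a (stieltjesInhom η a) (p n) A (pPrev p n) B z -
      crossForm η a (stieltjesInhom η a) (pPrev p n) B (p n) A z) -
    2 * (2 * (spectralW η a n).eval (xOf z) - (W η a).eval (xOf z))) ?_ ?_ ?_ ?_ ?_ hz
  · exact (((isLaurent_crossForm _ _ _ _ _ _ _).sub (isLaurent_crossForm _ _ _ _ _ _ _)).const_mul
      _).sub ((((hx.eval _).const_mul _).sub (hx.eval _)).const_mul _)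
  · intro z _
    simp only [crossForm_inv, xOf_inv]
    ring
  · have h := (((hasExpansion_crossForm_prev hη ha hp ha₀ n hA hB).sub
      (hasExpansion_crossForm_prev' hη ha hp ha₀ n hA hB)).sub (hasExpansion_spectralW η a n)).tendsto
    rw [show qbase η ^ n * (sig a 4 / qhalf η ^ 4) - -(qbase η ^ n)⁻¹ -
      ((qbase η ^ n)⁻¹ + sig a 4 / qhalf η ^ 4 * qbase η ^ n) = 0 by ring] at h
    exact h.congr fun z => by ring
  · have x1 : xOf 1 = 1 := by norm_num [xOf]
    simp only [hend 1 one_ne_zero inv_one, x1, eval_spectralW, eval_W]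
    ring
  · have x2 : xOf (-1) = -1 := by norm_num [xOf, inv_neg]
    simp only [hend (-1) (by norm_num) (by norm_num), x2, eval_spectralW, eval_W]
    ring

include hη ha hp in
/-- The sub-leading coefficient of `p_n`. -/
lemma gamSub_div_gam (n : ℕ) :
    2 * (qhalf η - (qhalf η)⁻¹) * ((qbase η ^ n)⁻¹ - sig a 4 / qhalf η ^ 4 * qbase η ^ n) *
      (gamSub p n / gam p n) =
    sig a 3 / qhalf η ^ 3 * (qbase η ^ n - 1) + sig a 1 / qhalf η * ((qbase η ^ n)⁻¹ - 1) := by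
  obtain ⟨A, hA⟩ := exists_isSecondKind_qFun hη ha p n
  obtain ⟨B, hB⟩ := exists_isSecondKind_qFunPrev hη ha p 1 n
  have h := (hasExpansion_crossForm_prev hη ha hp one_ne_zero n hA hB).sub
    (hasExpansion_crossForm_prev' hη ha hp one_ne_zero n hA hB)
  have h2 := h.congr (g := fun z =>
      2 * (2 * (spectralW η a n).eval (xOf z) - (W η a).eval (xOf z)) / z ^ 2) (by
    filter_upwards [HasExpansion.eventually_ne_zero] with z hz
    rw [← crossForm_sub_eq hη ha hp one_ne_zero n hA hB hz]
    ring)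
  -- The second coefficient was not used to identify $W_n$, so comparing it gives a linear equation
  -- for $\gamma_{n,1}/\gamma_n$.
  have h3 := (h2.unique (hasExpansion_spectralW η a n)).2
  linear_combination h3

/-- Expansion of `2 Δy` times a linear polynomial in `x(z)`. -/
lemma hasExpansion_deltaY_mul_linear (η D E : ℂ) :
    HasExpansion (fun z => 2 * deltaY η z * (D * xOf z + E) / z ^ 2)
      ((qhalf η - (qhalf η)⁻¹) / 2 * D) ((qhalf η - (qhalf η)⁻¹) * E) := by
  have hx := hasExpansion_xOf_div (c := 1) one_ne_zero
  simp only [one_mul] at hx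
  have hi : HasExpansion (fun z => z⁻¹) 0 1 := by simpa using HasExpansion.eval_inv X
  have h := ((hasExpansion_deltaY η).const_mul 2).mul ((hx.const_mul D).add (hi.const_mul E))
  convert h.congr ?_ using 1
  · ring
  · ring
  · exact Filter.Eventually.of_forall fun z => by simp only [div_eq_mul_inv]; ring

/-- The constant term of `Ω_n + V` in terms of the ratio `r = γ_{n,1}/γ_n`. -/
def omegaConst (η : ℂ) (a : Fin 4 → ℂ) (n : ℕ) (r : ℂ) : ℂ :=
  (-(qbase η ^ n * (sig a 3 / qhalf η ^ 3)) + (qbase η ^ n)⁻¹ * (sig a 1 / qhalf η)) /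
      (qhalf η - (qhalf η)⁻¹) -
    2 * r * (sig a 4 / qhalf η ^ 4 * qbase η ^ n + (qbase η ^ n)⁻¹)

-- The sum of the two cross forms is odd, so agreement to two orders at infinity suffices. The
-- constant term is kept in terms of $\gamma_{n,1}/\gamma_n$, so no denominator
-- $q^{-n}-q^{n-2}\sigma_4$ has to be non-zero here.
include hη ha hp ha₀ in
lemma crossForm_add_eq (n : ℕ) {A B : ℂ[X]} (hA : IsSecondKind η a (qFun η a p n) (p n) A)
    (hB : IsSecondKind η a (qFunPrev η a p a₀ n) (pPrev p n) B) {z : ℂ} (hz : z ≠ 0) :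
    recA p a₀ n * (crossForm η a (stieltjesInhom η a) (p n) A (pPrev p n) B z +
      crossForm η a (stieltjesInhom η a) (pPrev p n) B (p n) A z) =
    2 * deltaY η z * (2 * (qbase η ^ n * sig a 4 / qhalf η ^ 4 - (qbase η ^ n)⁻¹) /
      (qhalf η - (qhalf η)⁻¹) * xOf z + omegaConst η a n (gamSub p n / gam p n)) := by
  have hk := qhalf_sub_inv_ne_zero hη
  have hcancel : ∀ t, (qhalf η - (qhalf η)⁻¹) * (t / (qhalf η - (qhalf η)⁻¹)) = t :=
    fun t => mul_div_cancel₀ t hk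
  have hx : IsLaurent xOf := by simpa using IsLaurent.xOf (c := 1) one_ne_zero
  rw [← sub_eq_zero]
  set D := 2 * (qbase η ^ n * sig a 4 / qhalf η ^ 4 - (qbase η ^ n)⁻¹) /
      (qhalf η - (qhalf η)⁻¹) with hD
  refine IsLaurent.eq_zero_of_antisymm (F := fun z => recA p a₀ n *
      (crossForm η a (stieltjesInhom η a) (p n) A (pPrev p n) B z +
      crossForm η a (stieltjesInhom η a) (pPrev p n) B (p n) A z) -
    2 * deltaY η z * (D * xOf z + omegaConst η a n (gamSub p n / gam p n))) ?_ ?_ ?_ hz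
  · exact (((isLaurent_crossForm _ _ _ _ _ _ _).add (isLaurent_crossForm _ _ _ _ _ _ _)).const_mul
      _).sub (((isLaurent_deltaY η).const_mul 2).mul
        ((hx.const_mul D).add (IsLaurent.const _)))
  · intro z _
    simp only [crossForm_inv, xOf_inv, deltaY_inv]
    ring
  · have h := ((hasExpansion_crossForm_prev hη ha hp ha₀ n hA hB).add
      (hasExpansion_crossForm_prev' hη ha hp ha₀ n hA hB)).sub
      (hasExpansion_deltaY_mul_linear η D (omegaConst η a n (gamSub p n / gam p n)))
    have e0 : qbase η ^ n * (sig a 4 / qhalf η ^ 4) + -(qbase η ^ n)⁻¹ -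
        (qhalf η - (qhalf η)⁻¹) / 2 * D = 0 := by
      rw [hD]
      linear_combination -(1 / 2) * hcancel
        (2 * (qbase η ^ n * sig a 4 / qhalf η ^ 4 - (qbase η ^ n)⁻¹))
    have e1 : qbase η ^ n * (-(sig a 3 / qhalf η ^ 3) - sig a 4 / qhalf η ^ 4 *
        (gamSub p n / gam p n * (2 * (qhalf η - (qhalf η)⁻¹)))) +
        (qbase η ^ n)⁻¹ * (sig a 1 / qhalf η -
        (gamSub p n / gam p n * (2 * (qhalf η - (qhalf η)⁻¹)))) -
        (qhalf η - (qhalf η)⁻¹) * omegaConst η a n (gamSub p n / gam p n) = 0 := by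
      rw [omegaConst]
      linear_combination -hcancel
        (-(qbase η ^ n * (sig a 3 / qhalf η ^ 3)) + (qbase η ^ n)⁻¹ * (sig a 1 / qhalf η))
    rw [e0, e1] at h
    refine Filter.Tendsto.congr' ?_ h
    filter_upwards [HasExpansion.eventually_ne_zero] with z hz
    field_simp
    ring

end Spectral

/-! ### Algebraic identities -/

lemma prod_pairs_eq (a : Fin 4 → ℂ) (t : ℂ) : ∏ j, ∏ k ∈ Finset.Ioi j, (1 - a j * a k * t) =
    1 - sig a 2 * t + (sig a 1 * sig a 3 - sig a 4) * t ^ 2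
      - (sig a 1 ^ 2 * sig a 4 + sig a 3 ^ 2 - 2 * sig a 2 * sig a 4) * t ^ 3
      + (sig a 1 * sig a 3 - sig a 4) * sig a 4 * t ^ 4 - sig a 2 * sig a 4 ^ 2 * t ^ 5
      + sig a 4 ^ 3 * t ^ 6 := by
  have h0 : (Finset.Ioi 0 : Finset (Fin 4)) = {1, 2, 3} := by decide
  have h1 : (Finset.Ioi 1 : Finset (Fin 4)) = {2, 3} := by decide
  have h2 : (Finset.Ioi 2 : Finset (Fin 4)) = {3} := by decide
  have h3 : (Finset.Ioi 3 : Finset (Fin 4)) = ∅ := by decide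
  rw [Fin.prod_univ_four, h0, h1, h2, h3, Finset.prod_insert (by decide),
    Finset.prod_pair (by decide), Finset.prod_pair (by decide), Finset.prod_singleton,
    Finset.prod_empty, sig_one, sig_two, sig_three, sig_four]
  ring

/-- Here and below $h=q^{1/2}$ and $Q=q^n$; `r` is $\gamma_{n,1}/\gamma_n$. -/
lemma ratio_eq {h Q s1 s3 s4 r : ℂ} (h0 : h ≠ 0) (hh : h ^ 2 - 1 ≠ 0) (hQ : Q ≠ 0)
    (hE : h ^ 4 - s4 * Q ^ 2 ≠ 0)
    (hr : 2 * (h - h⁻¹) * (Q⁻¹ - s4 / h ^ 4 * Q) * r =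
      s3 / h ^ 3 * (Q - 1) + s1 / h * (Q⁻¹ - 1)) :
    r = (s3 * h ^ 2 * Q * (Q - 1) + s1 * h ^ 4 * (1 - Q)) /
      (2 * (h ^ 2 - 1) * (h ^ 4 - s4 * Q ^ 2)) := by
  rw [eq_div_iff (mul_ne_zero (mul_ne_zero two_ne_zero hh) hE)]
  field_simp at hr
  linear_combination hr

/-- `r` and `r'` are the ratios at $n$ and $n+1$, and $Qh^2=q^{n+1}$. The shift turns $h^4-s_4Q^2$
into $h^4(1-s_4Q^2)$, whence the two denominators of $b_n$. -/
lemma recB_identity {h Q s1 s3 s4 r r' : ℂ} (h0 : h ≠ 0) (hh : h ^ 2 - 1 ≠ 0) (hQ : Q ≠ 0)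
    (hE : h ^ 4 - s4 * Q ^ 2 ≠ 0) (hE' : 1 - s4 * Q ^ 2 ≠ 0)
    (hr : 2 * (h - h⁻¹) * (Q⁻¹ - s4 / h ^ 4 * Q) * r =
      s3 / h ^ 3 * (Q - 1) + s1 / h * (Q⁻¹ - 1))
    (hr' : 2 * (h - h⁻¹) * ((Q * h ^ 2)⁻¹ - s4 / h ^ 4 * (Q * h ^ 2)) * r' =
      s3 / h ^ 3 * (Q * h ^ 2 - 1) + s1 / h * ((Q * h ^ 2)⁻¹ - 1)) :
    r - r' = (s1 * (h ^ 2 + s4 * (Q ^ 2 - Q - Q / h ^ 2))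
        + s3 * (1 - Q - Q * h ^ 2 + s4 * (Q ^ 2 / h ^ 2))) *
      (Q / h ^ 2 / (2 * (1 - s4 * Q ^ 2) * (1 - s4 * (Q ^ 2 / h ^ 4)))) := by
  have hE2 : h ^ 4 - s4 * (Q * h ^ 2) ^ 2 = h ^ 4 * (1 - s4 * Q ^ 2) := by ring
  have hE3 : 1 - s4 * (Q ^ 2 / h ^ 4) = (h ^ 4 - s4 * Q ^ 2) / h ^ 4 := by field_simp
  rw [ratio_eq h0 hh hQ hE hr, ratio_eq h0 hh (mul_ne_zero hQ (pow_ne_zero 2 h0))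
    (by rw [hE2]; exact mul_ne_zero (pow_ne_zero 4 h0) hE') hr', hE2, hE3]
  clear hE2 hE3 hr hr'
  generalize e1 : h ^ 4 - s4 * Q ^ 2 = E at *
  generalize e2 : 1 - s4 * Q ^ 2 = E' at *
  generalize e3 : h ^ 2 - 1 = H at *
  field_simp
  subst e1 e2 e3
  ring

/-- Multiplying by the denominator brings in exactly the combination
$2(h-h^{-1})(Q^{-1}-s_4h^{-4}Q)\,r$ given by `hr`, so `r` is eliminated without solving for it. -/
lemma omegaConst_eq {η : ℂ} (hη : 0 < η.im) (a : Fin 4 → ℂ) (n : ℕ) {r : ℂ}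
    (hden : (qbase η ^ n)⁻¹ - sig a 4 / qhalf η ^ 4 * qbase η ^ n ≠ 0)
    (hr : 2 * (qhalf η - (qhalf η)⁻¹) *
        ((qbase η ^ n)⁻¹ - sig a 4 / qhalf η ^ 4 * qbase η ^ n) * r =
      sig a 3 / qhalf η ^ 3 * (qbase η ^ n - 1) + sig a 1 / qhalf η * ((qbase η ^ n)⁻¹ - 1)) :
    omegaConst η a n r = ((qbase η ^ n)⁻¹ / qhalf η * sig a 1
        + (-2 + (qbase η ^ n)⁻¹) / qhalf η ^ 3 * sig a 3
        + (-2 + qbase η ^ n) / qhalf η ^ 5 * sig a 1 * sig a 4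
        + qbase η ^ n / qhalf η ^ 7 * sig a 3 * sig a 4) /
      ((qhalf η - (qhalf η)⁻¹) * ((qbase η ^ n)⁻¹ - sig a 4 / qhalf η ^ 4 * qbase η ^ n)) := by
  have hk := qhalf_sub_inv_ne_zero hη
  have h0 := qhalf_ne_zero η
  have hQ := pow_ne_zero n (qbase_ne_zero η)
  rw [eq_div_iff (mul_ne_zero hk hden), omegaConst]
  generalize qbase η ^ n = Q at *
  have hc := mul_div_cancel₀ (-(Q * (sig a 3 / qhalf η ^ 3)) + Q⁻¹ * (sig a 1 / qhalf η)) hk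
  generalize (-(Q * (sig a 3 / qhalf η ^ 3)) + Q⁻¹ * (sig a 1 / qhalf η)) /
    (qhalf η - (qhalf η)⁻¹) = D at *
  have key : (-(Q * (sig a 3 / qhalf η ^ 3)) + Q⁻¹ * (sig a 1 / qhalf η)) *
      (Q⁻¹ - sig a 4 / qhalf η ^ 4 * Q) -
      (sig a 3 / qhalf η ^ 3 * (Q - 1) + sig a 1 / qhalf η * (Q⁻¹ - 1)) *
        (sig a 4 / qhalf η ^ 4 * Q + Q⁻¹) = Q⁻¹ / qhalf η * sig a 1
        + (-2 + Q⁻¹) / qhalf η ^ 3 * sig a 3 + (-2 + Q) / qhalf η ^ 5 * sig a 1 * sig a 4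
        + Q / qhalf η ^ 7 * sig a 3 * sig a 4 := by
    field_simp
    ring
  rw [← key]
  linear_combination (Q⁻¹ - sig a 4 / qhalf η ^ 4 * Q) * hc -
    (sig a 4 / qhalf η ^ 4 * Q + Q⁻¹) * hr

/-- The solution for `a_n²` of the determinantal identity for the spectral coefficients. -/
lemma recA_sq_identity {h Q s1 s2 s3 s4 α ω N : ℂ} (h0 : h ≠ 0) (hQ : Q ≠ 0)
    (hE1 : h ^ 6 - s4 * Q ^ 2 ≠ 0) (hE2 : h ^ 4 - s4 * Q ^ 2 ≠ 0) (hE3 : h ^ 2 - s4 * Q ^ 2 ≠ 0)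
    (hN : N = Q⁻¹ / h * s1 + (-2 + Q⁻¹) / h ^ 3 * s3 + (-2 + Q) / h ^ 5 * s1 * s4
      + Q / h ^ 7 * s3 * s4)
    (hω : ω * (Q⁻¹ - s4 / h ^ 4 * Q) = N)
    (hdet : α * (16 * (Q * s4 / h ^ 3 - Q⁻¹ / h) * (Q / h ^ 2 * s4 / h ^ 3 - (Q / h ^ 2)⁻¹ / h)) =
      ω ^ 2 + (2 * (-(1 + Q⁻¹) * (1 + s4 * Q / h ^ 4) + (1 + s2 / h ^ 2 + s4 / h ^ 4))
          - (-1 + s2 / h ^ 2 - s4 / h ^ 4)) ^ 2 - (-1 + s2 / h ^ 2 - s4 / h ^ 4) ^ 2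
        - (s1 / h - s3 / h ^ 3) ^ 2) :
    α = 1 / 4 * (((1 - Q) * (1 - s4 * (Q / h ^ 4)) *
        (1 - s2 * (Q / h ^ 2) + (s1 * s3 - s4) * (Q / h ^ 2) ^ 2
          - (s1 ^ 2 * s4 + s3 ^ 2 - 2 * s2 * s4) * (Q / h ^ 2) ^ 3
          + (s1 * s3 - s4) * s4 * (Q / h ^ 2) ^ 4 - s2 * s4 ^ 2 * (Q / h ^ 2) ^ 5
          + s4 ^ 3 * (Q / h ^ 2) ^ 6)) /
      ((1 - s4 * (Q ^ 2 / h ^ 6)) * (1 - s4 * (Q ^ 2 / h ^ 4)) ^ 2 *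
        (1 - s4 * (Q ^ 2 / h ^ 2)))) := by
  have e1 : 1 - s4 * (Q ^ 2 / h ^ 6) = (h ^ 6 - s4 * Q ^ 2) / h ^ 6 := by field_simp
  have e2 : 1 - s4 * (Q ^ 2 / h ^ 4) = (h ^ 4 - s4 * Q ^ 2) / h ^ 4 := by field_simp
  have e3 : 1 - s4 * (Q ^ 2 / h ^ 2) = (h ^ 2 - s4 * Q ^ 2) / h ^ 2 := by field_simp
  have hω' : ω = N * (Q * h ^ 4) / (h ^ 4 - s4 * Q ^ 2) := by
    rw [eq_div_iff hE2]
    have : h ^ 4 - s4 * Q ^ 2 = (Q⁻¹ - s4 / h ^ 4 * Q) * (Q * h ^ 4) := by field_simp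
    rw [this]
    linear_combination (Q * h ^ 4) * hω
  have hα : α * (16 * (h ^ 2 - s4 * Q ^ 2) * (h ^ 6 - s4 * Q ^ 2)) / (Q ^ 2 * h ^ 8) =
      α * (16 * (Q * s4 / h ^ 3 - Q⁻¹ / h) * (Q / h ^ 2 * s4 / h ^ 3 - (Q / h ^ 2)⁻¹ / h)) := by
    field_simp
    ring
  rw [← hα, hω', hN] at hdet
  have hα' : α = (((Q⁻¹ / h * s1 + (-2 + Q⁻¹) / h ^ 3 * s3 + (-2 + Q) / h ^ 5 * s1 * s4
      + Q / h ^ 7 * s3 * s4) * (Q * h ^ 4) / (h ^ 4 - s4 * Q ^ 2)) ^ 2 +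
      (2 * (-(1 + Q⁻¹) * (1 + s4 * Q / h ^ 4) + (1 + s2 / h ^ 2 + s4 / h ^ 4))
          - (-1 + s2 / h ^ 2 - s4 / h ^ 4)) ^ 2 - (-1 + s2 / h ^ 2 - s4 / h ^ 4) ^ 2
        - (s1 / h - s3 / h ^ 3) ^ 2) * (Q ^ 2 * h ^ 8) /
        (16 * (h ^ 2 - s4 * Q ^ 2) * (h ^ 6 - s4 * Q ^ 2)) := by
    rw [← hdet]
    field_simp
  rw [hα', e1, e2, e3]
  clear hα' hα hω' hdet hω hN e1 e2 e3
  generalize q1 : h ^ 6 - s4 * Q ^ 2 = E1 at *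
  generalize q2 : h ^ 4 - s4 * Q ^ 2 = E2 at *
  generalize q3 : h ^ 2 - s4 * Q ^ 2 = E3 at *
  field_simp
  subst q1 q2 q3
  ring

/-! ### The spectral coefficients -/

/-- Since $x(z)\to\infty$, it eventually leaves the finite root set of a non-zero difference. This
is the uniqueness of the spectral coefficients. -/
lemma eq_of_eventually_eval_xOf_eq {P Q : ℂ[X]}
    (h : ∀ᶠ z in Bornology.cobounded ℂ, P.eval (xOf z) = Q.eval (xOf z)) : P = Q := by
  rw [← sub_eq_zero]
  by_contra hne
  have hfin : {x | (P - Q).IsRoot x}.Finite := finite_setOfPred_isRoot hne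
  have hx := tendsto_xOf_cobounded (c := 1) one_ne_zero
  simp only [one_mul] at hx
  have hev := hx.eventually (Bornology.isBounded_def.1 hfin.isBounded)
  obtain ⟨z, hz1, hz2⟩ := (hev.and h).exists
  exact hz1 (by simp [IsRoot, hz2])

section Spectral

variable {η : ℂ} (hη : 0 < η.im) {a : Fin 4 → ℂ} (ha : ∀ j, ‖a j‖ < 1) {p : ℕ → ℂ[X]}
  (hp : IsOPS η a p) {a₀ : ℂ} (ha₀ : a₀ ≠ 0)

-- The cross-form identity, read where $|q^{1/2}z|>1$, gives existence; large $z$ give uniqueness.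
include hη ha hp ha₀ in
theorem isSpectralW_iff (n : ℕ) (P : ℂ[X]) :
    IsSpectralW η a p a₀ n P ↔ P = spectralW η a n := by
  obtain ⟨A, hA⟩ := exists_isSecondKind_qFun hη ha p n
  obtain ⟨B, hB⟩ := exists_isSecondKind_qFunPrev hη ha p a₀ n
  have har := hp.recA_ne_zero ha₀ n
  have key : ∀ z : ℂ, 1 < ‖qhalf η * z‖ →
      dataPlus η a z *
          ((p n).eval (yPlus η z) * qFunPrev η a p a₀ n (yMinus η z)
            - (pPrev p n).eval (yPlus η z) * qFun η a p n (yMinus η z))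
        + dataMinus η a z *
          ((p n).eval (yMinus η z) * qFunPrev η a p a₀ n (yPlus η z)
            - (pPrev p n).eval (yMinus η z) * qFun η a p n (yPlus η z)) =
      2 / recA p a₀ n * (2 * (spectralW η a n).eval (xOf z) - (W η a).eval (xOf z)) := by
    intro z hz
    obtain ⟨hz1, _⟩ := one_lt_norm_of_one_lt_norm_qhalf_mul hη hz
    have z0 : z ≠ 0 := by rintro rfl; simp at hz1; linarith
    have h := crossForm_sub_eq hη ha hp ha₀ n hA hB z0
    rw [stieltjesInhom, crossForm_eq hη ha hA hB hz, crossForm_eq hη ha hB hA hz] at h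
    rw [div_mul_eq_mul_div, eq_div_iff har]
    linear_combination h
  constructor
  · intro hP
    apply eq_of_eventually_eval_xOf_eq
    filter_upwards [eventually_one_lt_norm_qhalf_mul η] with z hz
    have h := hP z hz
    rw [key z hz] at h
    have h2 := mul_left_cancel₀ (div_ne_zero two_ne_zero har) h
    linear_combination h2 / 2
  · rintro rfl z hz
    exact (key z hz).symm

include hη ha hp in
theorem isSpectralTheta_iff (n : ℕ) (P : ℂ[X]) : IsSpectralTheta η a p n P ↔
    P = C (4 * (qbase η ^ n * sig a 4 / qhalf η ^ 3 - (qbase η ^ n)⁻¹ / qhalf η) /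
        (qhalf η - (qhalf η)⁻¹)) := by
  obtain ⟨A, hA⟩ := exists_isSecondKind_qFun hη ha p n
  have key : ∀ z : ℂ, 1 < ‖qhalf η * z‖ →
      dataPlus η a z * ((p n).eval (yPlus η z) * qFun η a p n (yMinus η z))
        - dataMinus η a z * ((p n).eval (yMinus η z) * qFun η a p n (yPlus η z)) =
      deltaY η z * (4 * (qbase η ^ n * sig a 4 / qhalf η ^ 3 - (qbase η ^ n)⁻¹ / qhalf η) /
        (qhalf η - (qhalf η)⁻¹)) := by
    intro z hz
    obtain ⟨hz1, _⟩ := one_lt_norm_of_one_lt_norm_qhalf_mul hη hz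
    have z0 : z ≠ 0 := by rintro rfl; simp at hz1; linarith
    rw [← crossForm_self hη ha hp n hA z0, stieltjesInhom, crossForm_eq hη ha hA hA hz]
  constructor
  · intro hP
    apply eq_of_eventually_eval_xOf_eq
    filter_upwards [eventually_one_lt_norm_qhalf_mul η] with z hz
    obtain ⟨hz1, _⟩ := one_lt_norm_of_one_lt_norm_qhalf_mul hη hz
    have h := hP z hz
    rw [key z hz] at h
    rw [eval_C]
    exact mul_left_cancel₀ (deltaY_ne_zero hη hz1) h
  · rintro rfl z hz
    rw [key z hz, eval_C]

include hη ha hp ha₀ in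
theorem isSpectralOmega_iff (n : ℕ) (P : ℂ[X]) : IsSpectralOmega η a p a₀ n P ↔
    P + V η a = C (2 * (qbase η ^ n * sig a 4 / qhalf η ^ 4 - (qbase η ^ n)⁻¹) /
      (qhalf η - (qhalf η)⁻¹)) * X + C (omegaConst η a n (gamSub p n / gam p n)) := by
  obtain ⟨A, hA⟩ := exists_isSecondKind_qFun hη ha p n
  obtain ⟨B, hB⟩ := exists_isSecondKind_qFunPrev hη ha p a₀ n
  have har := hp.recA_ne_zero ha₀ n
  set R := C (2 * (qbase η ^ n * sig a 4 / qhalf η ^ 4 - (qbase η ^ n)⁻¹) /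
      (qhalf η - (qhalf η)⁻¹)) * X + C (omegaConst η a n (gamSub p n / gam p n)) with hR
  have key : ∀ z : ℂ, 1 < ‖qhalf η * z‖ →
      dataPlus η a z *
          ((p n).eval (yPlus η z) * qFunPrev η a p a₀ n (yMinus η z)
            + (pPrev p n).eval (yPlus η z) * qFun η a p n (yMinus η z))
        + dataMinus η a z *
          (-((p n).eval (yMinus η z) * qFunPrev η a p a₀ n (yPlus η z))
            - (pPrev p n).eval (yMinus η z) * qFun η a p n (yPlus η z)) =
      2 * deltaY η z / recA p a₀ n * R.eval (xOf z) := by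
    intro z hz
    obtain ⟨hz1, _⟩ := one_lt_norm_of_one_lt_norm_qhalf_mul hη hz
    have z0 : z ≠ 0 := by rintro rfl; simp at hz1; linarith
    have h := crossForm_add_eq hη ha hp ha₀ n hA hB z0
    rw [stieltjesInhom, crossForm_eq hη ha hA hB hz, crossForm_eq hη ha hB hA hz] at h
    rw [div_mul_eq_mul_div, eq_div_iff har, hR]
    simp only [eval_add, eval_mul, eval_C, eval_X]
    linear_combination h
  constructor
  · intro hP
    apply eq_of_eventually_eval_xOf_eq
    filter_upwards [eventually_one_lt_norm_qhalf_mul η] with z hz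
    obtain ⟨hz1, _⟩ := one_lt_norm_of_one_lt_norm_qhalf_mul hη hz
    have h := hP z hz
    rw [key z hz] at h
    rw [eval_add]
    exact mul_left_cancel₀ (div_ne_zero (mul_ne_zero two_ne_zero (deltaY_ne_zero hη hz1)) har) h
  · intro hP z hz
    rw [key z hz, ← hP, eval_add]

/-! ### The recurrence coefficients -/

include hη ha hp in
/-- The determinantal identity for the spectral coefficients, evaluated at `x = 0`. -/
lemma recA_sq_det (n : ℕ) :
    recA p 0 (n + 1) ^ 2 * (16 *
        (qbase η ^ (n + 1) * sig a 4 / qhalf η ^ 3 - (qbase η ^ (n + 1))⁻¹ / qhalf η) *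
        (qbase η ^ n * sig a 4 / qhalf η ^ 3 - (qbase η ^ n)⁻¹ / qhalf η)) =
      ((qhalf η - (qhalf η)⁻¹) *
          omegaConst η a (n + 1) (gamSub p (n + 1) / gam p (n + 1))) ^ 2
        + (2 * (spectralW η a (n + 1)).eval 0 - (W η a).eval 0) ^ 2 - (W η a).eval 0 ^ 2
        - (sig a 1 / qhalf η - sig a 3 / qhalf η ^ 3) ^ 2 := by
  obtain ⟨A, hA⟩ := exists_isSecondKind_qFun hη ha p (n + 1)
  obtain ⟨B, hB⟩ := exists_isSecondKind_qFun hη ha p n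
  have hB' : IsSecondKind η a (qFunPrev η a p 1 (n + 1)) (pPrev p (n + 1)) B := hB
  have hk := qhalf_sub_inv_ne_zero hη
  have h0 := qhalf_ne_zero η
  have hI := Complex.I_ne_zero
  -- The cross-form identities hold for every $z\ne0$, not only where $|q^{1/2}z|>1$, so $z=i$ is
  -- admissible; there $x=0$ and $\Delta y=i(q^{1/2}-q^{-1/2})$.
  have hx : xOf Complex.I = 0 := by simp [xOf]
  have hd : deltaY η Complex.I = (qhalf η - (qhalf η)⁻¹) * Complex.I := by
    rw [deltaY_eq, Complex.inv_I]; ring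
  have hV : (qhalf η - (qhalf η)⁻¹) * (V η a).eval 0 =
      sig a 1 / qhalf η - sig a 3 / qhalf η ^ 3 := by
    rw [eval_V, mul_div_cancel₀ _ hk]; ring
  have d1 := crossForm_self hη ha hp (n + 1) hA hI
  have d2 := crossForm_self hη ha hp n hB hI
  have d3 := crossForm_sub_eq hη ha hp one_ne_zero (n + 1) hA hB' hI
  have d4 := crossForm_add_eq hη ha hp one_ne_zero (n + 1) hA hB' hI
  have d5 := crossForm_det η a (stieltjesInhom η a) (p (n + 1)) A (p n) B Complex.I
  have c1 : (p n * A - p (n + 1) * B).eval (yPlus η Complex.I) = 1 / recA p 1 (n + 1) :=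
    casoratian hη ha hp one_ne_zero (n + 1) hA hB' (mul_ne_zero h0 hI)
  have c2 : (p n * A - p (n + 1) * B).eval (yMinus η Complex.I) = 1 / recA p 1 (n + 1) :=
    casoratian hη ha hp one_ne_zero (n + 1) hA hB' (mul_ne_zero (inv_ne_zero h0) hI)
  -- The free value $a_0$ does not affect positive indices; $1$ served as a non-zero choice.
  have hr : recA p 1 (n + 1) = recA p 0 (n + 1) := rfl
  have har : recA p 0 (n + 1) ≠ 0 := hr ▸ hp.recA_ne_zero one_ne_zero (n + 1)
  rw [c1, c2, d1, d2, dataPlus, dataMinus, hx, hd, hr] at d5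
  rw [hx, hr] at d3
  rw [hx, hd, hr, mul_zero, zero_add] at d4
  simp only [pPrev] at d3 d4
  generalize crossForm η a (stieltjesInhom η a) (p (n + 1)) A (p n) B Complex.I = M at *
  generalize crossForm η a (stieltjesInhom η a) (p n) B (p (n + 1)) A Complex.I = M' at *
  generalize recA p 0 (n + 1) = α at *
  generalize omegaConst η a (n + 1) (gamSub p (n + 1) / gam p (n + 1)) = ω at *
  generalize (spectralW η a (n + 1)).eval 0 = Wn at *
  generalize (W η a).eval 0 = W₀ at *
  generalize (V η a).eval 0 = V₀ at *
  have t1 := mul_div_cancel₀ (4 * (qbase η ^ (n + 1) * sig a 4 / qhalf η ^ 3 -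
    (qbase η ^ (n + 1))⁻¹ / qhalf η)) hk
  have t2 := mul_div_cancel₀ (4 * (qbase η ^ n * sig a 4 / qhalf η ^ 3 -
    (qbase η ^ n)⁻¹ / qhalf η)) hk
  generalize 4 * (qbase η ^ (n + 1) * sig a 4 / qhalf η ^ 3 -
    (qbase η ^ (n + 1))⁻¹ / qhalf η) / (qhalf η - (qhalf η)⁻¹) = T1 at *
  generalize 4 * (qbase η ^ n * sig a 4 / qhalf η ^ 3 -
    (qbase η ^ n)⁻¹ / qhalf η) / (qhalf η - (qhalf η)⁻¹) = T2 at *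
  rw [← hV, show ∀ u v : ℂ, 16 * u * v = (4 * u) * (4 * v) by intros; ring, ← t1, ← t2]
  clear t1 t2 hV d1 d2 c1 c2
  generalize qhalf η - (qhalf η)⁻¹ = k at *
  have m1 : α * M = k * Complex.I * ω + (2 * Wn - W₀) := by linear_combination (d3 + d4) / 2
  have m2 : α * M' = k * Complex.I * ω - (2 * Wn - W₀) := by linear_combination (d4 - d3) / 2
  -- The two Casoratians contribute $a_n^{-2}$ to the determinant; multiplying through by $a_n^2$
  -- removes it.
  have m3 : α ^ 2 * (k * Complex.I * T1 * (k * Complex.I * T2)) - (α * M) * (α * M') =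
      (W₀ + k * Complex.I * V₀) * (W₀ - k * Complex.I * V₀) := by
    field_simp at d5
    linear_combination d5
  rw [m1, m2] at m3
  linear_combination (-1) * m3 + (α ^ 2 * k ^ 2 * T1 * T2 - k ^ 2 * ω ^ 2 + k ^ 2 * V₀ ^ 2) *
    Complex.I_sq

end Spectral

end AskeyWilson

end

/-! ### Assembly of the theorem, with integer powers of $q$ and $q^{1/2}$ rewritten through $q^n$ -/

open AskeyWilson in
theorem mainTheorem12 (η : ℂ) (hη : 0 < η.im) (a : Fin 4 → ℂ)
    (ha : ∀ j, ‖a j‖ < 1) (ha' : ∀ j, ‖(qhalf η)⁻¹ * a j‖ ≠ 1)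
    (p : ℕ → Polynomial ℂ) (hp : IsOPS η a p) (a₀ : ℂ) (ha₀ : a₀ ≠ 0) :
    -- the spectral data of the weight
    (∀ z : ℂ, z ≠ 0 →
      dataPlus η a z = z ^ (-2 : ℤ) * ∏ j, (1 - a j * (qhalf η)⁻¹ * z) ∧
      dataMinus η a z = z ^ (2 : ℤ) * ∏ j, (1 - a j * (qhalf η)⁻¹ * z⁻¹)) ∧
    -- the weight is semi-classical with these data on `G = (-1, 1)`
    (∀ z : ℂ, ‖z‖ = 1 → z ^ 2 ≠ 1 →
      dataPlus η a z ≠ 0 ∧ dataMinus η a z ≠ 0 ∧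
      (W η a).eval (xOf z) * dividedDiff η (weightZ η a) z =
        2 * (V η a).eval (xOf z) * meanOp η (weightZ η a) z) ∧
    -- the coefficient `W_n`
    (∀ (n : ℕ) (P : Polynomial ℂ), IsSpectralW η a p a₀ n P ↔
      P = Polynomial.C ((1 + qbase η ^ (-(n : ℤ))) * (1 + sig a 4 * qbase η ^ ((n : ℤ) - 2)))
            * (Polynomial.X ^ 2 - 1)
          - Polynomial.C (qhalf η ^ (-1 : ℤ) * sig a 1 + qhalf η ^ (-3 : ℤ) * sig a 3)
            * Polynomial.X
          + Polynomial.C (1 + qbase η ^ (-1 : ℤ) * sig a 2 + qbase η ^ (-2 : ℤ) * sig a 4)) ∧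
    -- the coefficient `Ω_n + V`
    (∀ (n : ℕ) (P : Polynomial ℂ),
      qbase η ^ (-(n : ℤ)) - qbase η ^ ((n : ℤ) - 2) * sig a 4 ≠ 0 →
      (IsSpectralOmega η a p a₀ n P ↔
        P + V η a =
          Polynomial.C (2 * ((qbase η ^ ((n : ℤ) - 2) * sig a 4 - qbase η ^ (-(n : ℤ)))
              / (qhalf η - (qhalf η)⁻¹))) * Polynomial.X
          + Polynomial.C
            ((qhalf η ^ (-2 * (n : ℤ) - 1) * sig a 1
                + (-2 + qbase η ^ (-(n : ℤ))) * qhalf η ^ (-3 : ℤ) * sig a 3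
                + (-2 + qbase η ^ (n : ℤ)) * qhalf η ^ (-5 : ℤ) * sig a 1 * sig a 4
                + qhalf η ^ (2 * (n : ℤ) - 7) * sig a 3 * sig a 4)
              / ((qhalf η - (qhalf η)⁻¹)
                * (qbase η ^ (-(n : ℤ)) - qbase η ^ ((n : ℤ) - 2) * sig a 4))))) ∧
    -- the coefficient `Θ_n`
    (∀ (n : ℕ) (P : Polynomial ℂ), IsSpectralTheta η a p n P ↔
      P = Polynomial.C (4 * ((qhalf η ^ (2 * (n : ℤ) - 3) * sig a 4
            - qhalf η ^ (-2 * (n : ℤ) - 1)) / (qhalf η - (qhalf η)⁻¹)))) ∧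
    -- the three-term recurrence
    (∀ n : ℕ, Polynomial.C (recA p 0 (n + 1)) * p (n + 1) =
      (Polynomial.X - Polynomial.C (recB p n)) * p n
        - Polynomial.C (recA p 0 n) * pPrev p n) ∧
    -- `a_n²`, with the convention `a₀ = 0`
    (∀ n : ℕ,
      (1 - sig a 4 * qbase η ^ (2 * (n : ℤ) - 3)) * (1 - sig a 4 * qbase η ^ (2 * (n : ℤ) - 2)) ^ 2
        * (1 - sig a 4 * qbase η ^ (2 * (n : ℤ) - 1)) ≠ 0 →
      recA p 0 n ^ 2 = 1 / 4 *
        (((1 - qbase η ^ (n : ℤ)) * (1 - sig a 4 * qbase η ^ ((n : ℤ) - 2))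
            * ∏ j, ∏ k ∈ Finset.Ioi j, (1 - a j * a k * qbase η ^ ((n : ℤ) - 1)))
          / ((1 - sig a 4 * qbase η ^ (2 * (n : ℤ) - 3))
            * (1 - sig a 4 * qbase η ^ (2 * (n : ℤ) - 2)) ^ 2
            * (1 - sig a 4 * qbase η ^ (2 * (n : ℤ) - 1))))) ∧
    -- `b_n`
    (∀ n : ℕ,
      (1 - sig a 4 * qbase η ^ (2 * (n : ℤ))) * (1 - sig a 4 * qbase η ^ (2 * (n : ℤ) - 2)) ≠ 0 →
      recB p n =
        (sig a 1 * (qbase η + sig a 4 * (qbase η ^ (2 * (n : ℤ)) - qbase η ^ (n : ℤ)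
              - qbase η ^ ((n : ℤ) - 1)))
          + sig a 3 * (1 - qbase η ^ (n : ℤ) - qbase η ^ ((n : ℤ) + 1)
              + sig a 4 * qbase η ^ (2 * (n : ℤ) - 1)))
        * (qbase η ^ ((n : ℤ) - 1)
          / (2 * (1 - sig a 4 * qbase η ^ (2 * (n : ℤ)))
            * (1 - sig a 4 * qbase η ^ (2 * (n : ℤ) - 2))))) := by
  have h0 := qhalf_ne_zero η
  have q0 := qbase_ne_zero η
  have hh : qhalf η ^ 2 - 1 ≠ 0 := sub_ne_zero.2 (qhalf_sq_ne_one hη)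
  have z1 : ∀ n : ℕ, qbase η ^ (-(n : ℤ)) = (qbase η ^ n)⁻¹ := fun n => by
    rw [zpow_neg, zpow_natCast]
  have z2 : ∀ n : ℕ, qbase η ^ ((n : ℤ) - 2) = qbase η ^ n / qhalf η ^ 4 := fun n => by
    rw [zpow_sub₀ q0, zpow_natCast, zpow_ofNat, qbase_eq_sq]; ring
  have z3 : ∀ n : ℕ, qhalf η ^ (-2 * (n : ℤ) - 1) = (qbase η ^ n)⁻¹ / qhalf η := fun n => by
    rw [zpow_sub₀ h0, zpow_mul, zpow_natCast, zpow_one, qbase_eq_sq, zpow_neg, zpow_ofNat, inv_pow]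
  have z4 : ∀ (n k : ℕ), qhalf η ^ (2 * (n : ℤ) - (k : ℤ)) = qbase η ^ n / qhalf η ^ k := fun n k => by
    rw [zpow_sub₀ h0, zpow_mul, zpow_natCast, zpow_natCast, qbase_eq_sq, zpow_ofNat]
  have z5 : qhalf η ^ (-1 : ℤ) = (qhalf η)⁻¹ ∧ qhalf η ^ (-3 : ℤ) = (qhalf η ^ 3)⁻¹ ∧
      qhalf η ^ (-5 : ℤ) = (qhalf η ^ 5)⁻¹ ∧ qbase η ^ (-1 : ℤ) = (qhalf η ^ 2)⁻¹ ∧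
      qbase η ^ (-2 : ℤ) = (qhalf η ^ 4)⁻¹ := by
    simp only [zpow_neg, zpow_ofNat, qbase_eq_sq, ← pow_mul]
    norm_num
  obtain ⟨u1, u3, u5, v1, v2⟩ := z5
  have z6 : ∀ (n k : ℕ), qbase η ^ (2 * (n : ℤ) - (k : ℤ)) = (qbase η ^ n) ^ 2 / qhalf η ^ (2 * k) :=
    fun n k => by
    rw [zpow_sub₀ q0, mul_comm, zpow_mul, zpow_natCast, zpow_natCast, zpow_ofNat, pow_mul,
      ← qbase_eq_sq]
  have z7 : ∀ n : ℕ, qbase η ^ ((n : ℤ) - 1) = qbase η ^ n / qhalf η ^ 2 := fun n => by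
    rw [zpow_sub₀ q0, zpow_natCast, zpow_one, ← qbase_eq_sq]
  have z8 : ∀ n : ℕ, qbase η ^ (2 * (n : ℤ)) = (qbase η ^ n) ^ 2 := fun n => by
    rw [mul_comm, zpow_mul, zpow_natCast, zpow_ofNat]
  have z9 : ∀ n : ℕ, qbase η ^ ((n : ℤ) + 1) = qbase η ^ n * qhalf η ^ 2 := fun n => by
    rw [zpow_add₀ q0, zpow_natCast, zpow_one, ← qbase_eq_sq]
  refine ⟨fun z hz => ⟨dataPlus_eq hη a hz, dataMinus_eq hη a hz⟩,
    fun z hz hz2 => data_ne_zero_and_semiclassical hη a ha' hz hz2, ?_, ?_, ?_, ?_, ?_, ?_⟩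
  · intro n P
    rw [isSpectralW_iff hη ha hp ha₀, spectralW, z1, z2, u1, u3, v1, v2]
    have e1 : sig a 1 / qhalf η + sig a 3 / qhalf η ^ 3 =
        (qhalf η)⁻¹ * sig a 1 + (qhalf η ^ 3)⁻¹ * sig a 3 := by ring
    have e2 : 1 + sig a 2 / qhalf η ^ 2 + sig a 4 / qhalf η ^ 4 =
        1 + (qhalf η ^ 2)⁻¹ * sig a 2 + (qhalf η ^ 4)⁻¹ * sig a 4 := by ring
    rw [e1, e2, mul_div_assoc]
  · intro n P hden
    have w7 := z4 n 7
    push_cast at w7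
    rw [z1, z2] at hden
    have hden' : (qbase η ^ n)⁻¹ - sig a 4 / qhalf η ^ 4 * qbase η ^ n ≠ 0 := by
      convert hden using 1; ring
    rw [isSpectralOmega_iff hη ha hp ha₀,
      omegaConst_eq hη a n hden' (gamSub_div_gam hη ha hp n), z1, z2, z3, w7, u3, u5, zpow_natCast]
    have e1 : 2 * (qbase η ^ n * sig a 4 / qhalf η ^ 4 - (qbase η ^ n)⁻¹) /
        (qhalf η - (qhalf η)⁻¹) = 2 * ((qbase η ^ n / qhalf η ^ 4 * sig a 4 - (qbase η ^ n)⁻¹) /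
        (qhalf η - (qhalf η)⁻¹)) := by ring
    have e2 : (qbase η ^ n)⁻¹ - sig a 4 / qhalf η ^ 4 * qbase η ^ n =
        (qbase η ^ n)⁻¹ - qbase η ^ n / qhalf η ^ 4 * sig a 4 := by ring
    rw [e1, e2]
    simp only [div_eq_mul_inv]
  · intro n P
    have w3 := z4 n 3
    push_cast at w3
    rw [isSpectralTheta_iff hη ha hp, z3, w3]
    have e1 : 4 * (qbase η ^ n * sig a 4 / qhalf η ^ 3 - (qbase η ^ n)⁻¹ / qhalf η) /
        (qhalf η - (qhalf η)⁻¹) = 4 * ((qbase η ^ n / qhalf η ^ 3 * sig a 4 -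
        (qbase η ^ n)⁻¹ / qhalf η) / (qhalf η - (qhalf η)⁻¹)) := by ring
    rw [e1]
  · exact three_term_recurrence hp.degree_eq (hp.functional hη ha)
  · intro n hden
    cases n with
    -- Both sides vanish: $a_0=0$ by convention and $1-q^0=0$.
    | zero => simp [recA]
    | succ n =>
    have w1 := z6 (n + 1) 1
    have w2 := z6 (n + 1) 2
    have w3 := z6 (n + 1) 3
    rw [Nat.cast_one] at w1
    rw [Nat.cast_ofNat] at w2 w3
    rw [w1, w2, w3] at hden ⊢
    norm_num only at hden ⊢
    rw [z2, z7, zpow_natCast, prod_pairs_eq]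
    have hdet := recA_sq_det hη ha hp n
    have hQ := pow_ne_zero (n + 1) q0
    have hQn : qbase η ^ n = qbase η ^ (n + 1) / qhalf η ^ 2 := by
      rw [← qbase_eq_sq, pow_succ]; field_simp
    have hr := gamSub_div_gam hη ha hp (n + 1)
    simp only [ne_eq, mul_eq_zero, not_or, pow_eq_zero_iff, OfNat.ofNat_ne_zero, not_false_eq_true]
      at hden
    obtain ⟨⟨d3, d2⟩, d1⟩ := hden
    have E1 : qhalf η ^ 6 - sig a 4 * (qbase η ^ (n + 1)) ^ 2 ≠ 0 := fun h => d3 (by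
      field_simp; linear_combination h)
    have E2 : qhalf η ^ 4 - sig a 4 * (qbase η ^ (n + 1)) ^ 2 ≠ 0 := fun h => d2 (by
      field_simp; linear_combination h)
    have E3 : qhalf η ^ 2 - sig a 4 * (qbase η ^ (n + 1)) ^ 2 ≠ 0 := fun h => d1 (by
      field_simp; linear_combination h)
    have hden' : (qbase η ^ (n + 1))⁻¹ - sig a 4 / qhalf η ^ 4 * qbase η ^ (n + 1) ≠ 0 := fun h =>
      E2 (by field_simp at h; linear_combination h)
    have hω := omegaConst_eq hη a (n + 1) hden' hr
    rw [eq_div_iff (mul_ne_zero (qhalf_sub_inv_ne_zero hη) hden')] at hω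
    -- The variable `ω` is the constant term of $\Omega_n+V$ freed of its factor
    -- $(q^{1/2}-q^{-1/2})^{-1}$, as it occurs in the determinant at $x=0$.
    refine recA_sq_identity h0 hQ E1 E2 E3 rfl
      (ω := (qhalf η - (qhalf η)⁻¹) * omegaConst η a (n + 1) (gamSub p (n + 1) / gam p (n + 1)))
      (by rw [← hω]; ring) ?_
    rw [← hQn, hdet, eval_spectralW, eval_W]
    ring
  · intro n hden
    have w1 := z6 n 1
    have w2 := z6 n 2
    rw [Nat.cast_one] at w1
    rw [Nat.cast_ofNat] at w2
    rw [w2, z8] at hden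
    rw [w1, w2, z8, z7, z9, zpow_natCast]
    norm_num only at hden ⊢
    obtain ⟨d1, d2⟩ := mul_ne_zero_iff.1 hden
    have E2 : qhalf η ^ 4 - sig a 4 * (qbase η ^ n) ^ 2 ≠ 0 := fun h => d2 (by
      field_simp; linear_combination h)
    have hr := gamSub_div_gam hη ha hp n
    have hr' := gamSub_div_gam hη ha hp (n + 1)
    rw [pow_succ, qbase_eq_sq η] at hr'
    rw [qbase_eq_sq η] at hr d1 E2 ⊢
    exact recB_identity h0 hh (pow_ne_zero n (pow_ne_zero 2 h0)) E2 d1 hr hr'
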